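/- **Theorem 3.5.** Let $d\ge 1$ and let $p(i,j)$ be a symmetric, translation invariant, irreducible Markov transition function of finite range on $\mathbb Z^d$. Let $\{\eta(t):t\ge 0\}$ be the system of independent random walkers on $\mathbb Z^d$ in which each particle at $i$ jumps to $j$ at rate $p(i,j)$, independently of the others. Start it from $\nu_\rho$, $\rho>0$, the product measure on $\mathbb N^{\mathbb Z^d}$ with Poisson($\rho$) marginals, and write $\mathbb E_{\nu_\rho}$ for the expectation. For a configuration $\xi$ with finitely many particles, $\|\xi\|=\sum_x\xi_x$, let $$D(\xi,\eta)=\prod_{x\in\mathbb Z^d}\ \sum_{j=0}^{\xi_x}\binom{\xi_x}{j}(-\rho)^{-j}\frac{\eta_x!}{(\eta_x-j)!},\qquad a(\xi)=\int D(\xi,\eta)^2\,d\nu_\rho(\eta),$$ where $\eta_x!/(\eta_x-j)!$ is read as $0$ for $j>\eta_x$ (Charlier polynomials). Let $\mathcal H_n$ be the closed linear span in $L^2(\nu_\rho)$ of the $D(\xi,\cdot)$ with $\|\xi\|\le n$. Let $f\in L^2(\nu_\rho)$ have the orthogonal expansion $f=\sum_\xi C_\xi D(\xi,\cdot)$, $C_\xi=\langle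 f,D(\xi,\cdot)\rangle_{L^2(\nu_\rho)}/a(\xi)$, and suppose that $$\sum_{\xi,\xi':\ \|\xi\|=\|\xi'\|}|C_\xi C_{\xi'}|\,a(\xi')<\infty .$$ Let $k\ge 1$ be an integer, let $f_{k-1}$ be the orthogonal projection of $f$ on $\mathcal H_{k-1}$, and for $N\ge 1$ and a real Schwartz function $\phi$ on $\mathbb R^d$ let $$\mathsf X_N(f-f_{k-1},\eta;\phi)=\sum_{x\in\mathbb Z^d}\phi\left(\tfrac xN\right)\bigl(f(\tau_x\eta)-f_{k-1}(\tau_x\eta)\bigr),\qquad (\tau_x\eta)_y=\eta_{x+y}.$$ At each time this series converges absolutely almost surely, and for every $t>0$ the product of $\mathsf X_N(f-f_{k-1},\eta(0);\phi)$ and $\mathsf X_N(f-f_{k-1},\eta(N^2t);\phi)$ is integrable and, as $N\to\infty$, $$\mathbb E_{\nu_\rho}\left[\mathsf X_N(f-f_{k-1},\eta(0);\phi)\,\mathsf X_N(f-f_{k-1},\eta(N^2t);\phi)\right]=O\left(N^{-d(k-2)}\right);$$ more precisely, there is a constant $C$, independent of $N$, such that the absolute value of the left-hand side is at most $C\,N^{-d(k-2)}$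 for all integers $N\ge 1$. -/

import Mathlib

open MeasureTheory ProbabilityTheory Topology
open scoped NNReal ENNReal SchwartzMap

noncomputable section

namespace IRW

/-- The lattice `ℤ^d`. -/
abbrev Site (d : ℕ) : Type := Fin d → ℤ

/-- Particle configurations `η ∈ ℕ^(ℤ^d)`; `η x` is the number of particles at `x`. -/
abbrev Config (d : ℕ) : Type := Site d → ℕ

/-- Configurations with finitely many particles; their number is `ξ.degree = ∑ x, ξ x`. -/
abbrev FinConfig (d : ℕ) : Type := Site d →₀ ℕ

/-- The spatial shift, `(τ_x η)_y = η_{y+x}`. -/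
def shift {d : ℕ} (x : Site d) (η : Config d) : Config d := fun y => η (y + x)

/-- `p` is the transition function of a translation invariant, symmetric, irreducible random walk
of finite range on `ℤ^d`. That `p i` is a probability distribution is built into `PMF`. -/
structure IsWalkTransition {d : ℕ} (p : Site d → PMF (Site d)) : Prop where
  symm : ∀ i j, p i j = p j i
  transl : ∀ i j, p i j = p 0 (j - i)
  finite_range : ∃ R : ℝ, 0 < R ∧ ∀ i j, R < ‖i - j‖ → p i j = 0
  irreducible : ∀ x y, Relation.ReflTransGen (fun i j => 0 < p i j) x y

/-- The law at time `t` of the continuous-time random walk with transition function `p` started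
from `x`: it jumps at the times of a Poisson process of rate one, so that its transition
probabilities are `∑ n, exp (-t) * t ^ n / n! * pⁿ(x, y)`, where `pⁿ` is the `n`-step transition
function. -/
def walkLaw {d : ℕ} (p : Site d → PMF (Site d)) (t : ℝ≥0) (x : Site d) : PMF (Site d) :=
  (poissonMeasure t).toPMF.bind fun n => (fun μ : PMF (Site d) => μ.bind p)^[n] (PMF.pure x)

/-- The particles initially at site `x` carry the labels `(x, i)` with `i < η x`. If the particle
with label `a` is at `X a`, this is the number of particles at each site. -/
def occupation {d : ℕ} (η : Config d) (X : Site d × ℕ → Site d) : Config d :=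
  fun y => {a : Site d × ℕ | a.2 < η a.1 ∧ X a = y}.ncard

/-- The occupation numbers depend measurably on the positions, so that the image measure in
`irwLaw` below is a probability measure. -/
theorem measurable_occupation {d : ℕ} (η : Config d) : Measurable (occupation η) := by
  rw [measurable_pi_iff]
  intro y
  have h : (fun X : Site d × ℕ → Site d => occupation η X y) = fun X =>
      (∑' a : Site d × ℕ, if a.2 < η a.1 ∧ X a = y then
        (1 : ℝ≥0∞) else 0).toReal.toNNReal |> fun r => ⌊r⌋₊ := by
    funext X
    have : (∑' a : Site d × ℕ, if a.2 < η a.1 ∧ X a = y then (1 : ℝ≥0∞) else 0)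
       = ({a : Site d × ℕ | a.2 < η a.1 ∧ X a = y}.encard : ℝ≥0∞) := by
      rw [← ENNReal.tsum_set_one, tsum_subtype {a : Site d × ℕ | a.2 < η a.1 ∧ X a = y} (fun _ => (1:ℝ≥0∞))]
      exact tsum_congr fun a => by simp [Set.indicator_apply]
    simp only [this, occupation, Set.ncard]
    cases h : ({a : Site d × ℕ | a.2 < η a.1 ∧ X a = y}.encard) <;> simp
  rw [h]
  have h2 : Measurable fun X : Site d × ℕ → Site d =>
      (∑' a : Site d × ℕ, if a.2 < η a.1 ∧ X a = y then (1 : ℝ≥0∞) else 0) := by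
    refine Measurable.tsum fun a => ?_
    refine Measurable.ite ?_ measurable_const measurable_const
    by_cases ha : a.2 < η a.1
    · simp only [ha, true_and]
      exact measurableSet_eq_fun (measurable_pi_apply a) measurable_const
    · simp [ha]
  exact Nat.measurable_floor.comp h2.ennreal_toReal.real_toNNReal

/-- The transition function of the system of independent random walkers: the law at time `t` of
the configuration, when at time `0` it is `η` and every particle performs its own independent
continuous-time random walk, so that each particle at `i` jumps to `j` at rate `p(i,j)`. -/
def irwLaw {d : ℕ} (p : Site d → PMF (Site d)) (t : ℝ≥0) (η : Config d) : Measure (Config d) :=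
  (Measure.infinitePi fun a : Site d × ℕ => (walkLaw p t a.1).toMeasure).map (occupation η)

/-- The information contained in the process up to time `s`. -/
abbrev past {Ω : Type*} {d : ℕ} (η : ℝ≥0 → Ω → Config d) (s : ℝ≥0) : MeasurableSpace Ω :=
  ⨆ r ≤ s, MeasurableSpace.comap (η r) inferInstance

/-- Under `P`, the process `η` is the Markov process of independent random walkers with single
particle transition function `p`: its conditional law at time `s + t`, given the past up to time
`s`, is `irwLaw p t (η s)`. -/
structure IsIRW {Ω : Type*} [MeasurableSpace Ω] {d : ℕ} (p : Site d → PMF (Site d))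
    (P : Measure Ω) (η : ℝ≥0 → Ω → Config d) : Prop where
  measurable : ∀ t, Measurable (η t)
  markov : ∀ (s t : ℝ≥0) (A : Set (Config d)), MeasurableSet A →
    P[(η (s + t) ⁻¹' A).indicator (fun _ => (1 : ℝ)) | past η s]
      =ᵐ[P] fun ω => (irwLaw p t (η s ω)).real A

/-- The homogeneous product measure `ν_ρ` with Poisson marginals of mean `ρ`. -/
def nu (d : ℕ) (ρ : ℝ≥0) : Measure (Config d) :=
  Measure.infinitePi fun _ : Site d => poissonMeasure ρ

/-- The Charlier polynomials
`d(k,n) = ₂F₀(-k, -n; ; -1/ρ) = ∑ j ≤ k, (k choose j) (-ρ)^(-j) n! / (n-j)!`. -/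
def charlier (ρ : ℝ≥0) (k n : ℕ) : ℝ :=
  ∑ j ∈ Finset.range (k + 1), (k.choose j : ℝ) * (-(ρ : ℝ))⁻¹ ^ j * (n.descFactorial j : ℝ)

/-- The orthogonal duality polynomials `D(ξ,η) = ∏ x, d(ξ_x, η_x)`. The product runs over the
support of `ξ`, the other factors being `d(0, η_x) = 1`. -/
def charlierD {d : ℕ} (ρ : ℝ≥0) (ξ : FinConfig d) (η : Config d) : ℝ :=
  ξ.prod fun x k => charlier ρ k (η x)

/-- `a(ξ) = ‖D(ξ,·)‖²` in `L²(ν_ρ)`. -/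
def normSq {d : ℕ} (ρ : ℝ≥0) (ξ : FinConfig d) : ℝ :=
  ∫ η, charlierD ρ ξ η ^ 2 ∂(nu d ρ)

/-- The coefficients `C_{n,ξ} = ⟨f, D(ξ,·)⟩ / a(ξ)`, `n = ‖ξ‖`, of the orthogonal expansion
`f = ∑ C_{n,ξ} D(ξ,·)` of `f ∈ L²(ν_ρ)`. -/
def charlierCoeff {d : ℕ} {ρ : ℝ≥0} (f : Lp ℝ 2 (nu d ρ)) (ξ : FinConfig d) : ℝ :=
  (∫ η, f η * charlierD ρ ξ η ∂(nu d ρ)) / normSq ρ ξ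

/-- The summability condition
`∑_{‖ξ‖ = ‖ξ'‖} |C_{n,ξ} C_{n,ξ'}| a(ξ') < ∞` on the expansion of `f`. -/
def ExpansionCondition {d : ℕ} {ρ : ℝ≥0} (f : Lp ℝ 2 (nu d ρ)) : Prop :=
  Summable fun q : {q : FinConfig d × FinConfig d // q.1.degree = q.2.degree} =>
    |charlierCoeff f q.1.1 * charlierCoeff f q.1.2| * normSq ρ q.1.2

/-- The Hilbert space `H_n`: the closed subspace of `L²(ν_ρ)` generated by the polynomials
`D(ξ,·)` with `‖ξ‖ ≤ n`. -/
def hilbertH (d : ℕ) (ρ : ℝ≥0) (n : ℕ) : Submodule ℝ (Lp ℝ 2 (nu d ρ)) :=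
  (Submodule.span ℝ {g : Lp ℝ 2 (nu d ρ) |
    ∃ ξ : FinConfig d, ξ.degree ≤ n ∧ g =ᵐ[nu d ρ] charlierD ρ ξ}).topologicalClosure

instance (d : ℕ) (ρ : ℝ≥0) (n : ℕ) : CompleteSpace (hilbertH d ρ n) :=
  inferInstanceAs (CompleteSpace (Submodule.topologicalClosure _))

/-- The orthogonal projection `f_n` of `f` on `H_n`. -/
def projH {d : ℕ} {ρ : ℝ≥0} (n : ℕ) (f : Lp ℝ 2 (nu d ρ)) : Lp ℝ 2 (nu d ρ) :=
  (hilbertH d ρ n).starProjection f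

/-- The point `x / N` of `ℝ^d`. -/
def scaled {d : ℕ} (N : ℕ) (x : Site d) : EuclideanSpace ℝ (Fin d) :=
  WithLp.toLp 2 fun i => (x i : ℝ) / N

/-- The fluctuation field `∑ x, φ(x/N) g(τ_x η)`. -/
def fluctField {d : ℕ} (N : ℕ) (φ : 𝓢(EuclideanSpace ℝ (Fin d), ℝ)) (g : Config d → ℝ)
    (η : Config d) : ℝ :=
  ∑' x : Site d, φ (scaled N x) * g (shift x η)

end IRW

end

/-! Expand `f - projH (k - 1) f` in Charlier polynomials: only the `D(ξ,·)` with `‖ξ‖ ≥ k` occur.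
The covariance of two shifted copies at times `0` and `T` is then a double series of pairings
`E[D(ξ,η(0)) D(ξ',η(T))]`, and everything rests on one bound for these pairings.

The bound comes from a Mecke equation for the joint law (`lintegral_jointLaw_mecke`): weighting by
the number of particles at `x` at time `0` amounts to adding a particle at `x`, and with it an
independent walker at time `T`. Together with the raising and lowering recursions of the Charlier
polynomials this gives `IsMeckeCoupling.pairing_add_single`: a particle of `ξ` at `x` is matched
with a particle of `ξ'` at `z`, at the cost of the transition probability from `x` to `z`. By
induction on the number of particles the pairing vanishes unless `‖ξ‖ = ‖ξ'‖ = n`, and is otherwise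
at most `occBound q n * a(ξ')`, where `q` bounds all transition probabilities at time `T`
(`IsMeckeCoupling.abs_pairing_le`). Each matching costs at most `min 1 (n q)`, so `occBound q` is
decreasing in `n`; for all `n ≥ k` it is at most `k! q ^ k`. The assumption on the coefficients of
`f` makes the double series finite, so each covariance is `O(q ^ k)`, uniformly in the two shifts.

The heat kernel estimate `exists_walkLaw_le` gives `q = O(N ^ (-d))` at `T = N² t`, hence
covariances of order `N ^ (-d k)`. The weights satisfy `∑ x, |φ(x/N)| = O(N ^ d)`, and squaring this
gives the remaining factor `N ^ (2 d)`.

Three ingredients support this: invariance of `ν_ρ`, derived from the fact that the Mecke equation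
characterizes it (`eq_nu_of_mecke`); orthogonality of the polynomials, which is the pairing
recursion for walkers that do not move; and their completeness, which follows from the self-duality
of the one-site Charlier polynomials. -/

noncomputable section

namespace IRW

/-! ### Resampling one coordinate of a product measure. -/

section Resampling

variable {ι : Type*} {X : ι → Type*} [∀ i, MeasurableSpace (X i)]

theorem measurable_update_prod [DecidableEq ι] (a : ι) :
    Measurable fun q : X a × (∀ i, X i) => Function.update q.2 a q.1 := by
  rw [measurable_pi_iff]
  intro i
  by_cases h : i = a
  · subst h; simpa using measurable_fst
  · simp only [Function.update_of_ne h]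
    exact (measurable_pi_apply i).comp measurable_snd

/-- Resampling one coordinate leaves a product measure invariant. -/
theorem infinitePi_eq_map_update [DecidableEq ι] (μ : ∀ i, Measure (X i))
    [∀ i, IsProbabilityMeasure (μ i)] (a : ι) :
    ((μ a).prod (Measure.infinitePi μ)).map (fun q => Function.update q.2 a q.1) =
      Measure.infinitePi μ := by
  refine Measure.eq_infinitePi μ fun s t ht => ?_
  rw [Measure.map_apply (measurable_update_prod a) (.pi s.countable_toSet fun i _ => ht i)]
  by_cases ha : a ∈ s
  · have : (fun q : X a × (∀ i, X i) => Function.update q.2 a q.1) ⁻¹' (Set.pi s t) =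
        (t a) ×ˢ (Set.pi (s.erase a : Finset ι) t) := by
      ext q
      simp only [Set.mem_preimage, Set.mem_pi, Set.mem_prod, Finset.mem_coe, Finset.mem_erase]
      constructor
      · intro h
        refine ⟨by simpa using h a ha, fun i hi => by simpa [hi.1] using h i hi.2⟩
      · rintro ⟨h1, h2⟩ i hi
        by_cases h : i = a
        · subst h; simpa using h1
        · simpa [h] using h2 i ⟨h, hi⟩
    rw [this, Measure.prod_prod, Measure.infinitePi_pi μ (fun i _ => ht i),
      Finset.mul_prod_erase s (fun i => μ i (t i)) ha]
  · have : (fun q : X a × (∀ i, X i) => Function.update q.2 a q.1) ⁻¹' (Set.pi s t) =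
        Set.univ ×ˢ (Set.pi s t) := by
      ext q
      simp only [Set.mem_preimage, Set.mem_pi, Set.mem_prod, Finset.mem_coe, Set.mem_univ,
        true_and]
      refine forall₂_congr fun i hi => ?_
      have hia : i ≠ a := fun h => ha (h ▸ hi)
      rw [Function.update_of_ne hia]
    rw [this, Measure.prod_prod, Measure.infinitePi_pi μ (fun i _ => ht i)]
    simp

theorem lintegral_infinitePi_update [DecidableEq ι] (μ : ∀ i, Measure (X i))
    [∀ i, IsProbabilityMeasure (μ i)] (a : ι) {F : (∀ i, X i) → ℝ≥0∞} (hF : Measurable F) :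
    ∫⁻ x, F x ∂(Measure.infinitePi μ) =
      ∫⁻ x, ∫⁻ z, F (Function.update x a z) ∂(μ a) ∂(Measure.infinitePi μ) := by
  conv_lhs => rw [← infinitePi_eq_map_update μ a]
  rw [lintegral_map hF (measurable_update_prod a), lintegral_prod_symm]
  exact (hF.comp (measurable_update_prod a)).aemeasurable

end Resampling

/-! ### One-site Charlier polynomials: self-duality and recursions. -/

section Charlier

/-- Writing the falling factorial as `j!` times a binomial coefficient makes the summand symmetric
in `k` and `n`. Terms with `j > k` vanish, so any upper limit `m ≥ k` will do. -/
theorem charlier_eq_sum_range (ρ : ℝ≥0) (k n m : ℕ) (hm : k ≤ m) :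
    charlier ρ k n = ∑ j ∈ Finset.range (m + 1),
      (j.factorial : ℝ) * (-(ρ : ℝ))⁻¹ ^ j * (k.choose j : ℝ) * (n.choose j : ℝ) := by
  rw [charlier, ← Finset.sum_subset (Finset.range_subset_range.2 (Nat.succ_le_succ hm))]
  · refine Finset.sum_congr rfl fun j _ => ?_
    rw [Nat.descFactorial_eq_factorial_mul_choose]
    push_cast
    ring
  · intro j _ hj
    rw [Nat.choose_eq_zero_of_lt (by simpa using hj)]
    simp

/-- Self-duality. It converts recursions in the degree into recursions in the occupation number, and
later orthogonality into completeness. -/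
theorem charlier_comm (ρ : ℝ≥0) (k n : ℕ) : charlier ρ k n = charlier ρ n k := by
  rw [charlier_eq_sum_range ρ k n (k + n) (by lia), charlier_eq_sum_range ρ n k (k + n) (by lia)]
  exact Finset.sum_congr rfl fun j _ => by ring

@[simp] theorem charlier_zero_left (ρ : ℝ≥0) (n : ℕ) : charlier ρ 0 n = 1 := by
  simp [charlier]

/-- Pascal's rule for `(k + 1).choose j`. The truncated `n - 1` is harmless at `n = 0`, where its
coefficient vanishes. -/
theorem charlier_succ_left (ρ : ℝ≥0) (k n : ℕ) :
    charlier ρ (k + 1) n = charlier ρ k n - (n : ℝ) / ρ * charlier ρ k (n - 1) := by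
  rcases n with _ | n
  · rw [charlier_comm, charlier_comm ρ k]; simp
  have h1 : ∀ j, ((n + 1).descFactorial (j + 1) : ℝ) = (n + 1) * n.descFactorial j := by
    intro j; rw [Nat.succ_descFactorial_succ]; push_cast; ring
  have h2 : charlier ρ k (n + 1) = ∑ j ∈ Finset.range (k + 2), (k.choose j : ℝ) *
      (-(ρ : ℝ))⁻¹ ^ j * ((n + 1).descFactorial j : ℝ) := by
    rw [Finset.sum_range_succ, Nat.choose_succ_self]; simp [charlier]
  rw [h2, charlier, charlier, Finset.sum_range_succ', Finset.sum_range_succ' _ (k + 1)]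
  simp only [h1, Nat.choose_succ_succ, Nat.add_sub_cancel]
  rw [Finset.mul_sum]
  have : ∀ a b c z : ℝ, a = b - c → a + z = b + z - c := by intros; linarith
  push_cast
  simp only [Nat.choose_zero_right]
  apply this
  rw [← Finset.sum_sub_distrib]
  refine Finset.sum_congr rfl fun j _ => ?_
  rw [pow_succ, inv_neg]
  field_simp
  ring

theorem charlier_succ_right (ρ : ℝ≥0) (k n : ℕ) :
    charlier ρ k (n + 1) = charlier ρ k n - (k : ℝ) / ρ * charlier ρ (k - 1) n := by
  rw [charlier_comm, charlier_succ_left, charlier_comm, charlier_comm ρ n (k - 1)]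

/-- From `n ^ j ≤ j! * exp n`. Exponential growth is square integrable under a Poisson law. -/
theorem exists_abs_charlier_le (ρ : ℝ≥0) (k : ℕ) :
    ∃ C : ℝ, 0 ≤ C ∧ ∀ n : ℕ, |charlier ρ k n| ≤ C * Real.exp n := by
  refine ⟨∑ j ∈ Finset.range (k + 1), |(k.choose j : ℝ) * (-(ρ : ℝ))⁻¹ ^ j| * j.factorial,
    by positivity, fun n => ?_⟩
  rw [charlier, Finset.sum_mul]
  refine (Finset.abs_sum_le_sum_abs _ _).trans (Finset.sum_le_sum fun j _ => ?_)
  rw [abs_mul, mul_assoc _ (j.factorial : ℝ), Nat.abs_cast]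
  gcongr
  have h1 : (n.descFactorial j : ℝ) ≤ (n : ℝ) ^ j := by
    exact_mod_cast Nat.descFactorial_le_pow n j
  have h2 := Real.pow_div_factorial_le_exp (n : ℝ) (by positivity) j
  rw [div_le_iff₀ (by positivity)] at h2
  linarith

theorem memLp_charlier (ρ : ℝ≥0) (k : ℕ) : MemLp (charlier ρ k) 2 (poissonMeasure ρ) := by
  obtain ⟨C, hC, h⟩ := exists_abs_charlier_le ρ k
  rw [memLp_two_iff_integrable_sq .of_discrete, integrable_poissonMeasure_iff]
  have : Summable fun n : ℕ => Real.exp (-ρ) * C ^ 2 * (((ρ : ℝ) * Real.exp 2) ^ n / n.factorial) :=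
    (Real.summable_pow_div_factorial _).mul_left _
  refine this.of_nonneg_of_le (fun n => by positivity) fun n => ?_
  have h3 : ‖charlier ρ k n ^ 2‖ ≤ (C * Real.exp n) ^ 2 := by
    rw [norm_pow]; exact pow_le_pow_left₀ (norm_nonneg _) (h n) 2
  calc _ ≤ Real.exp (-ρ) * ρ ^ n / n.factorial * (C * Real.exp n) ^ 2 := by gcongr
    _ = _ := by
      rw [mul_pow, mul_pow, ← Real.exp_nat_mul, ← Real.exp_nat_mul]
      push_cast
      rw [mul_comm (n : ℝ) 2]
      ring

end Charlier

/-! ### The Mecke equation and its converse. -/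

section Poisson

/-- The configuration with a single particle, located at `x`. -/
def atom {d : ℕ} (x : Site d) : Config d := fun y => if y = x then 1 else 0

@[simp] theorem atom_apply {d : ℕ} (x y : Site d) : atom x y = if y = x then 1 else 0 := rfl

variable {d : ℕ} {ρ : ℝ≥0}

instance isProbabilityMeasure_nu : IsProbabilityMeasure (nu d ρ) := by
  unfold nu; infer_instance

theorem lintegral_nu_update (x : Site d) {F : Config d → ℝ≥0∞} (hF : Measurable F) :
    ∫⁻ η, F η ∂(nu d ρ) =
      ∫⁻ η, ∫⁻ n, F (Function.update η x n) ∂(poissonMeasure ρ) ∂(nu d ρ) :=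
  lintegral_infinitePi_update (X := fun _ : Site d => ℕ) (fun _ => poissonMeasure ρ) x hF

@[fun_prop]
theorem measurable_eval_cast (x : Site d) : Measurable fun η : Config d => (η x : ℝ≥0∞) :=
  (Measurable.of_discrete (f := fun n : ℕ => (n : ℝ≥0∞))).comp (measurable_pi_apply x)

/-- One-site Mecke equation: the Poisson weights satisfy `(n + 1) π(n + 1) = ρ π(n)`, and the term
`n = 0` drops out. -/
theorem lintegral_poissonMeasure_mul (f : ℕ → ℝ≥0∞) :
    ∫⁻ n, n * f n ∂(poissonMeasure ρ) = ρ * ∫⁻ n, f (n + 1) ∂(poissonMeasure ρ) := by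
  rw [lintegral_countable', lintegral_countable', tsum_eq_zero_add' ENNReal.summable,
    ← ENNReal.tsum_mul_left]
  simp only [Nat.cast_zero, zero_mul, zero_add]
  refine tsum_congr fun n => ?_
  have : ((n + 1 : ℕ) : ℝ≥0∞) * poissonMeasure ρ {n + 1} = ρ * poissonMeasure ρ {n} := by
    rw [poissonMeasure_singleton, poissonMeasure_singleton, ← ENNReal.ofReal_natCast,
      ← ENNReal.ofReal_coe_nnreal, ← ENNReal.ofReal_mul (by positivity),
      ← ENNReal.ofReal_mul (by positivity)]
    congr 1
    rw [Nat.factorial_succ]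
    push_cast
    field_simp
    ring
  calc _ = f (n + 1) * (((n + 1 : ℕ) : ℝ≥0∞) * poissonMeasure ρ {n + 1}) := by ring
    _ = _ := by rw [this]; ring

theorem measurable_add_atom (x : Site d) :
    Measurable fun η : Config d => η + atom x :=
  measurable_id.add_const _

theorem update_add_atom (η : Config d) (x : Site d) (n : ℕ) :
    Function.update η x n + atom x = Function.update η x (n + 1) := by
  ext y
  by_cases h : y = x
  · subst h; simp
  · simp [h]

/-- The Mecke equation of the Poisson product measure. -/
theorem lintegral_nu_mecke (x : Site d) {F : Config d → ℝ≥0∞} (hF : Measurable F) :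
    ∫⁻ η, η x * F η ∂(nu d ρ) = ρ * ∫⁻ η, F (η + atom x) ∂(nu d ρ) := by
  have h := lintegral_nu_update (ρ := ρ) x (hF.comp (measurable_add_atom x))
  simp only [Function.comp_apply, update_add_atom] at h
  rw [lintegral_nu_update x (by fun_prop), h, ← lintegral_const_mul']
  · refine lintegral_congr fun η => ?_
    simp only [Function.update_self]
    exact lintegral_poissonMeasure_mul fun n => F (Function.update η x n)
  · simp

/-- The Mecke equation characterizes the Poisson product measure. -/
theorem eq_nu_of_mecke (μ : Measure (Config d)) [IsProbabilityMeasure μ]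
    (h : ∀ (x : Site d) (F : Config d → ℝ≥0∞), Measurable F →
      ∫⁻ η, η x * F η ∂μ = ρ * ∫⁻ η, F (η + atom x) ∂μ) :
    μ = nu d ρ := by
  -- For an event `E` insensitive to particles at `x`, the Mecke equation tested on `{η x = n + 1} ∩
  -- E` is the Poisson recursion for `n ↦ μ(η x = n, E)`. So `η x` is Poisson and independent of
  -- `E`; sites are then split off one at a time.
  have key : ∀ (x : Site d) (E : Set (Config d)), MeasurableSet E →
      (∀ η, η + atom x ∈ E ↔ η ∈ E) → ∀ A : Set ℕ,
      μ ((fun η => η x) ⁻¹' A ∩ E) = poissonMeasure ρ A * μ E := by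
    intro x E hE hinv A
    have hmeas : ∀ n : ℕ, MeasurableSet ((fun η : Config d => η x) ⁻¹' {n} ∩ E) := fun n =>
      (measurable_pi_apply x (measurableSet_singleton n)).inter hE
    have hstep : ∀ n : ℕ, ((n + 1 : ℕ) : ℝ≥0∞) * μ ((fun η => η x) ⁻¹' {n + 1} ∩ E) =
        ρ * μ ((fun η => η x) ⁻¹' {n} ∩ E) := by
      intro n
      have := h x (((fun η => η x) ⁻¹' {n + 1} ∩ E).indicator 1)
        (measurable_one.indicator (hmeas (n + 1)))
      have h1 : ∀ η : Config d, (η x : ℝ≥0∞) * ((fun η : Config d => η x) ⁻¹' {n + 1} ∩ E).indicator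
          (1 : Config d → ℝ≥0∞) η = ((fun η : Config d => η x) ⁻¹' {n + 1} ∩ E).indicator
          (fun _ => ((n + 1 : ℕ) : ℝ≥0∞)) η := by
        intro η
        by_cases hη : η ∈ (fun η : Config d => η x) ⁻¹' {n + 1} ∩ E
        · rw [Set.indicator_of_mem hη, Set.indicator_of_mem hη]
          simp [show η x = n + 1 from hη.1]
        · rw [Set.indicator_of_notMem hη, Set.indicator_of_notMem hη, mul_zero]
      have h2 : ∀ η : Config d, ((fun η : Config d => η x) ⁻¹' {n + 1} ∩ E).indicator
          (1 : Config d → ℝ≥0∞) (η + atom x) =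
          ((fun η : Config d => η x) ⁻¹' {n} ∩ E).indicator 1 η := by
        intro η
        by_cases h1 : η x = n <;> by_cases h2 : η ∈ E <;>
          simp [hinv, h1, h2]
      rw [lintegral_congr h1, lintegral_congr h2] at this
      rwa [lintegral_indicator_const (hmeas _), lintegral_indicator_one (hmeas _)] at this
    have hform : ∀ n : ℕ, μ ((fun η => η x) ⁻¹' {n} ∩ E) =
        ENNReal.ofReal (ρ ^ n / n.factorial) * μ ((fun η => η x) ⁻¹' {0} ∩ E) := by
      intro n
      induction n with
      | zero => simp
      | succ n ih =>
        have h0 : ((n + 1 : ℕ) : ℝ≥0∞) ≠ 0 := by simp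
        have h1 : ((n + 1 : ℕ) : ℝ≥0∞) ≠ ∞ := ENNReal.natCast_ne_top _
        refine (ENNReal.mul_right_inj h0 h1).1 ?_
        rw [hstep, ih, ← mul_assoc, ← mul_assoc]
        congr 1
        rw [← ENNReal.ofReal_natCast, ← ENNReal.ofReal_coe_nnreal,
          ← ENNReal.ofReal_mul (by positivity), ← ENNReal.ofReal_mul (by positivity)]
        congr 1
        rw [Nat.factorial_succ]
        push_cast
        field_simp
        ring
    have hsum : ∀ B : Set ℕ, μ ((fun η => η x) ⁻¹' B ∩ E) =
        ∑' n, B.indicator (fun n => μ ((fun η => η x) ⁻¹' {n} ∩ E)) n := by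
      intro B
      have e : (fun η : Config d => η x) ⁻¹' B ∩ E =
          ⋃ n : ℕ, (fun η : Config d => η x) ⁻¹' ({n} ∩ B) ∩ E := by
        ext η; simp
      rw [e, measure_iUnion]
      · refine tsum_congr fun n => ?_
        by_cases hn : n ∈ B
        · rw [Set.indicator_of_mem hn, Set.inter_eq_left.2 (Set.singleton_subset_iff.2 hn)]
        · rw [Set.indicator_of_notMem hn, Set.singleton_inter_eq_empty.2 hn]; simp
      · intro m n hmn
        refine Set.disjoint_left.2 fun η h1 h2 => hmn ?_
        exact (show η x = m from h1.1.1).symm.trans h2.1.1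
      · intro n
        exact (measurable_pi_apply x (.of_discrete)).inter hE
    have hpois : ∀ n : ℕ, ENNReal.ofReal (ρ ^ n / n.factorial) =
        ENNReal.ofReal (Real.exp ρ) * poissonMeasure ρ {n} := by
      intro n
      rw [poissonMeasure_singleton, ← ENNReal.ofReal_mul (by positivity), ← mul_div_assoc,
        ← mul_assoc, ← Real.exp_add]
      simp
    have hgen : ∀ B : Set ℕ, μ ((fun η => η x) ⁻¹' B ∩ E) =
        poissonMeasure ρ B * (ENNReal.ofReal (Real.exp ρ) * μ ((fun η => η x) ⁻¹' {0} ∩ E)) := by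
      intro B
      rw [hsum, ← Measure.tsum_indicator_apply_singleton _ B (.of_discrete),
        ← ENNReal.tsum_mul_right]
      refine tsum_congr fun n => ?_
      by_cases hn : n ∈ B
      · rw [Set.indicator_of_mem hn, Set.indicator_of_mem hn, hform, hpois]
        ring
      · simp [Set.indicator_of_notMem hn]
    -- The recursion leaves the constant `exp ρ * μ(η x = 0, E)` free; total mass identifies it as
    -- `μ E`.
    have huniv := hgen Set.univ
    rw [Set.preimage_univ, Set.univ_inter, measure_univ, one_mul] at huniv
    rw [hgen A, ← huniv]
  refine Measure.eq_infinitePi _ fun s t ht => ?_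
  induction s using Finset.induction_on with
  | empty => simp
  | insert a s ha ih =>
    rw [Finset.prod_insert ha, ← ih, ← key a (Set.pi s t)
      (.pi s.countable_toSet fun i _ => ht i) ?_ (t a)]
    · congr 1
      ext η
      simp
    · intro η
      simp only [Set.mem_pi, Finset.mem_coe]
      refine forall₂_congr fun i hi => ?_
      have : i ≠ a := fun h => ha (h ▸ hi)
      simp [this]

end Poisson

/-! ### Occupation numbers of labelled particles. -/

section Occupation

variable {d : ℕ}

/-- Number of particles at each site when the particles with labels in `S` are counted. -/
def occS (S : Set (Site d × ℕ)) (X : Site d × ℕ → Site d) : Config d :=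
  fun y => {a : Site d × ℕ | a ∈ S ∧ X a = y}.ncard

/-- The labels in use for the initial configuration `η`. -/
def alive (η : Config d) : Set (Site d × ℕ) := {a | a.2 < η a.1}

theorem tsum_indicator_eq_encard {α : Type*} (s : Set α) :
    ∑' a, s.indicator (fun _ => (1 : ℝ≥0∞)) a = (s.encard : ℝ≥0∞) := by
  rw [← ENNReal.tsum_set_one, tsum_subtype s (fun _ => (1 : ℝ≥0∞))]

/-- The count is a countable sum of measurable indicators. The conversion through `toReal` agrees
with `ncard` on infinite sets too, both giving `0`. The label set may be random, which yields joint
measurability in the initial configuration. -/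
theorem measurable_ncard_family {Γ : Type*} [MeasurableSpace Γ] {A : Γ → Set (Site d × ℕ)}
    (hA : ∀ a, MeasurableSet {γ | a ∈ A γ}) {X : Γ → Site d × ℕ → Site d} (hX : Measurable X) :
    Measurable fun γ => occS (A γ) (X γ) := by
  rw [measurable_pi_iff]
  intro y
  have h : (fun γ => occS (A γ) (X γ) y) = fun γ =>
      ⌊(∑' a : Site d × ℕ, {a | a ∈ A γ ∧ X γ a = y}.indicator
        (fun _ => (1 : ℝ≥0∞)) a).toReal.toNNReal⌋₊ := by
    funext γ
    rw [tsum_indicator_eq_encard]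
    simp only [occS, Set.ncard]
    cases h : ({a : Site d × ℕ | a ∈ A γ ∧ X γ a = y}.encard) <;> simp
  rw [h]
  have h2 : Measurable fun γ => ∑' a : Site d × ℕ, {a | a ∈ A γ ∧ X γ a = y}.indicator
        (fun _ => (1 : ℝ≥0∞)) a := by
    refine Measurable.tsum fun a => ?_
    have hm : MeasurableSet {γ | a ∈ A γ ∧ X γ a = y} :=
      (hA a).inter (((measurable_pi_apply a).comp hX) (measurableSet_singleton y))
    exact (measurable_const (a := (1 : ℝ≥0∞))).indicator hm
  exact Nat.measurable_floor.comp h2.ennreal_toReal.real_toNNReal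

theorem measurable_occS (S : Set (Site d × ℕ)) : Measurable (occS S) :=
  measurable_ncard_family (A := fun _ => S) (fun _ => .const _) measurable_id

theorem measurable_occupation_prod :
    Measurable fun q : Config d × (Site d × ℕ → Site d) => occupation q.1 q.2 := by
  refine measurable_ncard_family (A := fun q : Config d × (Site d × ℕ → Site d) => alive q.1)
    (X := Prod.snd) (fun a => ?_) measurable_snd
  exact measurableSet_lt measurable_const ((measurable_pi_apply a.1).comp measurable_fst)

/-- Finiteness is needed because `ncard` of an infinite set is `0`, so an extra particle would not
be counted there. -/
theorem occS_insert_update {S : Set (Site d × ℕ)} {a : Site d × ℕ} (ha : a ∉ S)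
    {X : Site d × ℕ → Site d} (hX : ∀ y, {a | a ∈ S ∧ X a = y}.Finite) (z : Site d) :
    occS (insert a S) (Function.update X a z) = occS S X + atom z := by
  have h1 : ∀ b ∈ S, Function.update X a z b = X b := fun b hb => by
    have : b ≠ a := fun h => ha (h ▸ hb)
    simp [this]
  ext y
  simp only [occS, Pi.add_apply]
  by_cases hy : y = z
  · subst hy
    have : {b | b ∈ insert a S ∧ Function.update X a y b = y} =
        insert a {b | b ∈ S ∧ X b = y} := by
      ext b
      simp only [Set.mem_ofPred_eq, Set.mem_insert_iff]
      constructor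
      · rintro ⟨rfl | hb, h⟩
        · exact Or.inl rfl
        · exact Or.inr ⟨hb, by rwa [h1 b hb] at h⟩
      · rintro (rfl | ⟨hb, h⟩)
        · simp
        · exact ⟨Or.inr hb, by rwa [h1 b hb]⟩
    rw [this, Set.ncard_insert_of_notMem (fun h => ha h.1) (hX y)]
    simp
  · have : {b | b ∈ insert a S ∧ Function.update X a z b = y} = {b | b ∈ S ∧ X b = y} := by
      ext b
      simp only [Set.mem_ofPred_eq, Set.mem_insert_iff]
      constructor
      · rintro ⟨rfl | hb, h⟩
        · exact absurd (by simpa using h.symm) hy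
        · exact ⟨hb, by rwa [h1 b hb] at h⟩
      · rintro ⟨hb, h⟩
        exact ⟨Or.inr hb, by rwa [h1 b hb]⟩
    rw [this]
    simp [hy]

theorem tsum_alive (η : Config d) (g : Site d → ℝ≥0∞) :
    ∑' a, (alive η).indicator (fun a => g a.1) a = ∑' x, (η x : ℝ≥0∞) * g x := by
  rw [ENNReal.tsum_prod']
  refine tsum_congr fun x => ?_
  rw [tsum_eq_sum (s := Finset.range (η x))]
  · rw [Finset.sum_congr rfl (g := fun _ => g x)]
    · simp
    · intro i hi
      exact Set.indicator_of_mem (s := alive η) (by simpa [alive] using hi) _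
  · intro i hi
    exact Set.indicator_of_notMem (s := alive η) (by simpa [alive] using hi) _

theorem alive_add_atom (η : Config d) (x : Site d) :
    alive (η + atom x) = insert (x, η x) (alive η) := by
  ext ⟨y, i⟩
  simp only [alive, Set.mem_ofPred_eq, Set.mem_insert_iff, Prod.mk.injEq, Pi.add_apply]
  by_cases h : y = x
  · subst h; simp; lia
  · simp [h]

end Occupation

/-! ### The law of the configuration at time `t` from a fixed initial state. -/

section Law

variable {d : ℕ} (p : Site d → PMF (Site d)) (t : ℝ≥0)

/-- The joint law at time `t` of the positions of all labelled particles. -/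
def posLaw : Measure (Site d × ℕ → Site d) :=
  Measure.infinitePi fun a : Site d × ℕ => (walkLaw p t a.1).toMeasure

instance : IsProbabilityMeasure (posLaw p t) := by
  unfold posLaw; infer_instance

/-- The particles with labels in `S` have finite expected occupation numbers at time `t`. -/
def LocFin (S : Set (Site d × ℕ)) : Prop :=
  ∀ y, ∑' a, S.indicator (fun a => walkLaw p t a.1 y) a ≠ ∞

variable {p t}

theorem LocFin.mono {S T : Set (Site d × ℕ)} (hT : LocFin p t T) (h : S ⊆ T) : LocFin p t S :=
  fun y => ne_top_of_le_ne_top (hT y)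
    (ENNReal.tsum_le_tsum fun _ => Set.indicator_le_indicator_of_subset h (fun _ => zero_le) _)

theorem posLaw_eval (a : Site d × ℕ) (y : Site d) :
    posLaw p t {X | X a = y} = walkLaw p t a.1 y := by
  have h := (measurePreserving_eval_infinitePi
    (fun a : Site d × ℕ => (walkLaw p t a.1).toMeasure) a).measure_preimage
    (measurableSet_singleton y).nullMeasurableSet
  rw [PMF.toMeasure_apply_singleton _ _ (measurableSet_singleton y)] at h
  exact h

/-- Borel–Cantelli, site by site. -/
theorem LocFin.ae_finite {S : Set (Site d × ℕ)} (hS : LocFin p t S) :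
    ∀ᵐ X ∂(posLaw p t), ∀ y, {a | a ∈ S ∧ X a = y}.Finite := by
  rw [ae_all_iff]
  intro y
  have := ae_finite_setOfPred_mem (μ := posLaw p t)
    (s := fun a : Site d × ℕ => {X | a ∈ S ∧ X a = y}) (ne_top_of_le_ne_top (hS y) ?_)
  · exact this
  · refine ENNReal.tsum_le_tsum fun a => ?_
    by_cases ha : a ∈ S
    · simp [ha, posLaw_eval]
    · simp [ha]

theorem lintegral_posLaw_update (a : Site d × ℕ) {F : (Site d × ℕ → Site d) → ℝ≥0∞}
    (hF : Measurable F) :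
    ∫⁻ X, F X ∂(posLaw p t) =
      ∫⁻ X, ∫⁻ z, F (Function.update X a z) ∂(walkLaw p t a.1).toMeasure ∂(posLaw p t) :=
  lintegral_infinitePi_update (X := fun _ : Site d × ℕ => Site d)
    (fun a : Site d × ℕ => (walkLaw p t a.1).toMeasure) a hF

theorem measurable_add_atom_prod :
    Measurable fun q : Site d × Config d => q.2 + atom q.1 := by
  have : Measurable fun z : Site d => atom z := .of_discrete
  exact measurable_snd.add (this.comp measurable_fst)

/-- An additional particle performs its own walk. -/
theorem lintegral_occS_insert {S : Set (Site d × ℕ)} (hS : LocFin p t S) {a : Site d × ℕ}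
    (ha : a ∉ S) {G : Site d → Config d → ℝ≥0∞} (hG : ∀ z, Measurable (G z)) :
    ∫⁻ X, G (X a) (occS (insert a S) X) ∂(posLaw p t) =
      ∫⁻ z, ∫⁻ X, G z (occS S X + atom z) ∂(posLaw p t) ∂(walkLaw p t a.1).toMeasure := by
  have hG' : Measurable (Function.uncurry G) := measurable_from_prod_countable_right hG
  have m1 : Measurable fun X : Site d × ℕ → Site d => G (X a) (occS (insert a S) X) :=
    hG'.comp ((measurable_pi_apply a).prodMk (measurable_occS _))
  have m2 : Measurable fun q : (Site d × ℕ → Site d) × Site d =>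
      G q.2 (occS S q.1 + atom q.2) := by
    refine hG'.comp (measurable_snd.prodMk ?_)
    exact measurable_add_atom_prod.comp
      (measurable_snd.prodMk ((measurable_occS S).comp measurable_fst))
  rw [lintegral_posLaw_update a m1, ← lintegral_lintegral_swap
    (f := fun X z => G z (occS S X + atom z)) m2.aemeasurable]
  refine lintegral_congr_ae ?_
  filter_upwards [hS.ae_finite] with X hX
  refine lintegral_congr fun z => ?_
  rw [occS_insert_update ha hX, Function.update_self]

theorem lintegral_occS_insert_comm {S : Set (Site d × ℕ)} (hS : LocFin p t S) {a b : Site d × ℕ}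
    (ha : a ∉ S) (hb : b ∉ S) (hab : a.1 = b.1) {F : Config d → ℝ≥0∞} (hF : Measurable F) :
    ∫⁻ X, F (occS (insert a S) X) ∂(posLaw p t) =
      ∫⁻ X, F (occS (insert b S) X) ∂(posLaw p t) := by
  rw [lintegral_occS_insert hS ha (G := fun _ => F) fun _ => hF,
    lintegral_occS_insert hS hb (G := fun _ => F) fun _ => hF, hab]

/-- Removing any particle at a site has the same effect in law as removing the one with the last
label, because particles starting at the same site are exchangeable. Only the latter leaves a label
set of the form `alive ζ`. -/
theorem lintegral_occS_alive_diff {η : Config d} (hη : LocFin p t (alive η)) {a : Site d × ℕ}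
    (ha : a ∈ alive η) {F : Config d → ℝ≥0∞} (hF : Measurable F) :
    ∫⁻ X, F (occS (alive η \ {a}) X) ∂(posLaw p t) =
      ∫⁻ X, F (occS (alive (η - atom a.1)) X) ∂(posLaw p t) := by
  obtain ⟨x, i⟩ := a
  have hi : i < η x := ha
  set ζ := η - atom x with hζ
  have hζx : ζ x + 1 = η x := by simp [hζ]; lia
  have hηζ : η = ζ + atom x := by
    ext y
    by_cases h : y = x
    · subst h; simp [hζx]
    · simp [hζ, h]
  have hal : alive η = insert (x, ζ x) (alive ζ) := by rw [hηζ]; exact alive_add_atom ζ x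
  have hlast : (x, ζ x) ∉ alive ζ := by simp [alive]
  by_cases hix : i = ζ x
  · rw [hix, hal, Set.insert_sdiff_of_mem _ (Set.mem_singleton _),
      Set.sdiff_singleton_eq_self hlast]
  · have hmem : (x, i) ∈ alive ζ := by
      have : i < ζ x := by lia
      simpa [alive] using this
    have e1 : alive η \ {(x, i)} = insert (x, ζ x) (alive ζ \ {(x, i)}) := by
      rw [hal, Set.insert_sdiff_of_notMem]
      simpa using fun h => hix h.symm
    have e2 : alive ζ = insert (x, i) (alive ζ \ {(x, i)}) := by
      rw [Set.insert_sdiff_singleton, Set.insert_eq_of_mem hmem]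
    have h3 : alive ζ \ {(x, i)} ⊆ alive η := by
      rw [hal]
      exact Set.sdiff_subset.trans (Set.subset_insert _ _)
    rw [e1, lintegral_occS_insert_comm (b := (x, i)) (hη.mono h3) (fun h => hlast h.1) (by simp)
      rfl hF, ← e2]

theorem lintegral_irwLaw (η : Config d) {F : Config d → ℝ≥0∞} (hF : Measurable F) :
    ∫⁻ ζ, F ζ ∂(irwLaw p t η) = ∫⁻ X, F (occS (alive η) X) ∂(posLaw p t) :=
  lintegral_map hF (measurable_occupation η)

instance (η : Config d) : IsProbabilityMeasure (irwLaw p t η) :=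
  Measure.isProbabilityMeasure_map (measurable_occupation η).aemeasurable

theorem lintegral_irwLaw_add_atom {η : Config d} (hη : LocFin p t (alive η)) (x : Site d)
    {F : Config d → ℝ≥0∞} (hF : Measurable F) :
    ∫⁻ ζ, F ζ ∂(irwLaw p t (η + atom x)) =
      ∫⁻ z, ∫⁻ ζ, F (ζ + atom z) ∂(irwLaw p t η) ∂(walkLaw p t x).toMeasure := by
  rw [lintegral_irwLaw _ hF, alive_add_atom,
    lintegral_occS_insert hη (by simp [alive]) (G := fun _ => F) fun _ => hF]
  refine lintegral_congr fun z => ?_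
  exact (lintegral_irwLaw η (hF.comp (measurable_add_atom z))).symm

/-- Write `ζ y` as the sum over particles of the indicator of being at `y`. Each particle is
independent of the rest, which evolve from `η - atom x`, and the `η x` particles at `x` contribute
equally. -/
theorem lintegral_irwLaw_mecke {η : Config d} (hη : LocFin p t (alive η)) (y : Site d)
    {F : Config d → ℝ≥0∞} (hF : Measurable F) :
    ∫⁻ ζ, ζ y * F ζ ∂(irwLaw p t η) =
      ∑' x, η x * (walkLaw p t x y *
        ∫⁻ ζ, F (ζ + atom y) ∂(irwLaw p t (η - atom x))) := by
  have hFy : Measurable fun ζ : Config d => F (ζ + atom y) :=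
    hF.comp (measurable_add_atom y)
  rw [← tsum_alive η fun x => walkLaw p t x y *
        ∫⁻ ζ, F (ζ + atom y) ∂(irwLaw p t (η - atom x)),
    lintegral_irwLaw η (by fun_prop)]
  have h1 : ∀ᵐ X ∂(posLaw p t), (occS (alive η) X y : ℝ≥0∞) * F (occS (alive η) X) =
      ∑' a, (alive η).indicator
        (fun a => ({y} : Set (Site d)).indicator 1 (X a) * F (occS (alive η) X)) a := by
    filter_upwards [hη.ae_finite] with X hX
    have : (occS (alive η) X y : ℝ≥0∞) =
        ∑' a, {a | a ∈ alive η ∧ X a = y}.indicator (fun _ => (1 : ℝ≥0∞)) a := by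
      rw [tsum_indicator_eq_encard, occS, ← (hX y).cast_ncard_eq]
      simp
    rw [this, ← ENNReal.tsum_mul_right]
    refine tsum_congr fun a => ?_
    by_cases ha : a ∈ alive η <;> by_cases hy : X a = y <;> simp [ha, hy]
  rw [lintegral_congr_ae h1, lintegral_tsum]
  · refine tsum_congr fun a => ?_
    by_cases ha : a ∈ alive η
    · simp only [Set.indicator_of_mem ha]
      have e : alive η = insert a (alive η \ {a}) := by
        rw [Set.insert_sdiff_singleton, Set.insert_eq_of_mem ha]
      have h2 := lintegral_occS_insert (hη.mono (Set.sdiff_subset (t := {a}))) (a := a) (by simp)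
        (G := fun z ζ => ({y} : Set (Site d)).indicator 1 z * F ζ) (fun z => by fun_prop)
      rw [← e] at h2
      rw [h2, lintegral_countable', tsum_eq_single y]
      · rw [PMF.toMeasure_apply_singleton _ _ (measurableSet_singleton y), mul_comm]
        simp only [Set.indicator_of_mem (Set.mem_singleton y), Pi.one_apply, one_mul]
        rw [lintegral_occS_alive_diff hη ha hFy, lintegral_irwLaw _ hFy]
      · intro z hz
        simp [hz]
    · simp [Set.indicator_of_notMem ha]
  · intro a
    by_cases ha : a ∈ alive η
    · simp only [Set.indicator_of_mem ha]
      refine Measurable.aemeasurable (Measurable.mul ?_ (hF.comp (measurable_occS _)))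
      exact (measurable_one.indicator (measurableSet_singleton y)).comp (measurable_pi_apply a)
    · simp [Set.indicator_of_notMem ha]

variable (p t) in
/-- The transition kernel of the system of independent random walkers. -/
def irwKernel : Kernel (Config d) (Config d) where
  toFun := irwLaw p t
  measurable' := by
    refine Measure.measurable_of_measurable_coe _ fun s hs => ?_
    have h : ∀ η, irwLaw p t η s = posLaw p t
        (Prod.mk η ⁻¹' ((fun q : Config d × (Site d × ℕ → Site d) => occupation q.1 q.2) ⁻¹' s)) :=
      fun η => Measure.map_apply (measurable_occupation η) hs
    simp_rw [h]
    exact measurable_measure_prodMk_left (measurable_occupation_prod hs)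

theorem irwKernel_apply (η : Config d) : irwKernel p t η = irwLaw p t η := rfl

instance : IsMarkovKernel (irwKernel p t) :=
  ⟨fun η => by rw [irwKernel_apply]; infer_instance⟩

end Law

/-! ### Invariance of the Poisson measure and the Mecke equation in two times. -/

section Stationarity

variable {d : ℕ} {p : Site d → PMF (Site d)} {t : ℝ≥0} {ρ : ℝ≥0}

theorem iterate_bind_eq (p : Site d → PMF (Site d)) (n : ℕ) (μ : PMF (Site d)) :
    (fun μ : PMF (Site d) => μ.bind p)^[n] μ =
      μ.bind fun z => (fun μ : PMF (Site d) => μ.bind p)^[n] (PMF.pure z) := by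
  induction n generalizing μ with
  | zero => simp
  | succ n ih =>
    rw [Function.iterate_succ_apply']
    simp_rw [Function.iterate_succ_apply']
    rw [ih, PMF.bind_bind]

/-- Reversal of paths: `n + 1` steps from `x` are split at the last step and those from `y` at the
first. -/
theorem walkLaw_symm (hp : ∀ i j, p i j = p j i) (t : ℝ≥0) (x y : Site d) :
    walkLaw p t x y = walkLaw p t y x := by
  have h : ∀ (n : ℕ) (x y : Site d), (fun μ : PMF (Site d) => μ.bind p)^[n] (PMF.pure x) y =
      (fun μ : PMF (Site d) => μ.bind p)^[n] (PMF.pure y) x := by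
    intro n
    induction n with
    | zero => intro x y; simp [PMF.pure_apply, eq_comm]
    | succ n ih =>
      intro x y
      rw [Function.iterate_succ_apply', Function.iterate_succ_apply, PMF.pure_bind,
        iterate_bind_eq p n (p y), PMF.bind_apply, PMF.bind_apply]
      refine tsum_congr fun z => ?_
      rw [ih x z, hp z y, mul_comm]
  simp only [walkLaw, PMF.bind_apply, h _ x y]

theorem tsum_walkLaw_left (hp : ∀ i j, p i j = p j i) (t : ℝ≥0) (y : Site d) :
    ∑' x, walkLaw p t x y = 1 := by
  simp_rw [walkLaw_symm hp t _ y]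
  exact (walkLaw p t y).tsum_coe

theorem lintegral_nu_eval (x : Site d) : ∫⁻ η, (η x : ℝ≥0∞) ∂(nu d ρ) = ρ := by
  simpa using lintegral_nu_mecke (ρ := ρ) x (F := fun _ => 1) measurable_const

/-- The expected number of particles at `y` is `ρ` times the sum over `x` of the transition
probabilities to `y`. By symmetry that sum is `1`, so the number is almost surely finite in
conditional expectation. -/
theorem ae_locFin_alive (hp : ∀ i j, p i j = p j i) :
    ∀ᵐ η ∂(nu d ρ), LocFin p t (alive η) := by
  unfold LocFin
  rw [ae_all_iff]
  intro y
  simp_rw [tsum_alive _ fun x => walkLaw p t x y]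
  have : ∫⁻ η : Config d, ∑' x, (η x : ℝ≥0∞) * walkLaw p t x y ∂(nu d ρ) = ρ := by
    rw [lintegral_tsum fun x => ((measurable_eval_cast x).mul_const _).aemeasurable]
    simp_rw [lintegral_mul_const' _ _ (PMF.apply_ne_top _ _), lintegral_nu_eval]
    rw [ENNReal.tsum_mul_left, tsum_walkLaw_left hp, mul_one]
  have hm : Measurable fun η : Config d => ∑' x, (η x : ℝ≥0∞) * walkLaw p t x y :=
    Measurable.tsum fun x => (measurable_eval_cast x).mul_const _
  filter_upwards [ae_lt_top hm (by rw [this]; simp)] with η hη using hη.ne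

/-- The Poisson product measure is invariant. -/
theorem nu_bind_irwKernel (hp : ∀ i j, p i j = p j i) :
    (nu d ρ).bind (irwKernel p t) = nu d ρ := by
  have : IsProbabilityMeasure ((nu d ρ).bind (irwKernel p t)) := inferInstance
  refine eq_nu_of_mecke _ fun y F hF => ?_
  have hFy : Measurable fun ζ : Config d => F (ζ + atom y) :=
    hF.comp (measurable_add_atom y)
  have hK : Measurable fun η => ∫⁻ ζ, F (ζ + atom y) ∂(irwLaw p t η) :=
    hFy.lintegral_kernel (κ := irwKernel p t)
  have hsub : ∀ x : Site d, Measurable fun η : Config d => η - atom x := fun x => by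
    fun_prop
  rw [Measure.lintegral_bind (irwKernel p t).aemeasurable (by fun_prop),
    Measure.lintegral_bind (irwKernel p t).aemeasurable hFy.aemeasurable]
  simp only [irwKernel_apply]
  have h1 : ∀ᵐ η ∂(nu d ρ), ∫⁻ ζ, ζ y * F ζ ∂(irwLaw p t η) =
      ∑' x, η x * (walkLaw p t x y *
        ∫⁻ ζ, F (ζ + atom y) ∂(irwLaw p t (η - atom x))) := by
    filter_upwards [ae_locFin_alive (t := t) hp] with η hη using lintegral_irwLaw_mecke hη y hF
  have hK' : ∀ x, Measurable fun η : Config d => walkLaw p t x y *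
      ∫⁻ ζ, F (ζ + atom y) ∂(irwLaw p t (η - atom x)) := fun x =>
    (hK.comp (hsub x)).const_mul _
  rw [lintegral_congr_ae h1, lintegral_tsum fun x => by
    have := hK' x
    fun_prop]
  -- The Mecke equation at time `0` adds the particle that `η - atom x` had removed. What remains
  -- depends on `x` only through the transition probability to `y`, and these sum to `1` over `x` by
  -- symmetry.
  have h2 : ∀ x : Site d, ∫⁻ η, η x * (walkLaw p t x y *
        ∫⁻ ζ, F (ζ + atom y) ∂(irwLaw p t (η - atom x))) ∂(nu d ρ) =
      walkLaw p t x y * (ρ * ∫⁻ η, ∫⁻ ζ, F (ζ + atom y) ∂(irwLaw p t η) ∂(nu d ρ)) := by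
    intro x
    rw [lintegral_nu_mecke x (hK' x)]
    simp only [add_tsub_cancel_right]
    rw [lintegral_const_mul _ hK]
    ring
  simp_rw [h2]
  rw [ENNReal.tsum_mul_right, tsum_walkLaw_left hp, one_mul]

variable (p t ρ) in
/-- The joint law of the configurations at times `0` and `t` in the stationary process. -/
def jointLaw : Measure (Config d × Config d) := (nu d ρ) ⊗ₘ (irwKernel p t)

theorem measurePreserving_fst_jointLaw :
    MeasurePreserving Prod.fst (jointLaw p t ρ) (nu d ρ) :=
  ⟨measurable_fst, Measure.fst_compProd (nu d ρ) (irwKernel p t)⟩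

theorem measurePreserving_snd_jointLaw (hp : ∀ i j, p i j = p j i) :
    MeasurePreserving Prod.snd (jointLaw p t ρ) (nu d ρ) :=
  ⟨measurable_snd, (Measure.snd_compProd (nu d ρ) (irwKernel p t)).trans (nu_bind_irwKernel hp)⟩

/-- The Mecke equation of the joint law. -/
theorem lintegral_jointLaw_mecke (hp : ∀ i j, p i j = p j i) (x : Site d)
    {H : Config d × Config d → ℝ≥0∞} (hH : Measurable H) :
    ∫⁻ q, q.1 x * H q ∂(jointLaw p t ρ) =
      ρ * ∫⁻ z, ∫⁻ q, H (q.1 + atom x, q.2 + atom z) ∂(jointLaw p t ρ)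
        ∂(walkLaw p t x).toMeasure := by
  unfold jointLaw
  have hHz : ∀ z, Measurable fun q : Config d × Config d =>
      H (q.1 + atom x, q.2 + atom z) := fun z => by fun_prop
  have hm : Measurable fun q : Config d × Config d => (q.1 x : ℝ≥0∞) * H q := by fun_prop
  have hK : Measurable fun η => ∫⁻ ζ, H (η, ζ) ∂(irwKernel p t η) := hH.lintegral_kernel_prod_right'
  rw [Measure.lintegral_compProd hm]
  have h1 : ∀ η : Config d, ∫⁻ ζ, (η x : ℝ≥0∞) * H (η, ζ) ∂(irwKernel p t η) =
      η x * ∫⁻ ζ, H (η, ζ) ∂(irwKernel p t η) := fun η => lintegral_const_mul _ (by fun_prop)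
  simp only [h1]
  rw [lintegral_nu_mecke x hK]
  congr 1
  -- The particle added by the one-time Mecke equation moves independently of the rest and is at `z`
  -- at time `t`.
  have h2 : ∀ᵐ η ∂(nu d ρ), ∫⁻ ζ, H (η + atom x, ζ) ∂(irwKernel p t (η + atom x)) =
      ∫⁻ z, ∫⁻ ζ, H (η + atom x, ζ + atom z) ∂(irwKernel p t η)
        ∂(walkLaw p t x).toMeasure := by
    filter_upwards [ae_locFin_alive (t := t) hp] with η hη
    exact lintegral_irwLaw_add_atom hη x (F := fun ζ => H (η + atom x, ζ)) (by fun_prop)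
  rw [lintegral_congr_ae h2, lintegral_lintegral_swap]
  · refine lintegral_congr fun z => ?_
    rw [Measure.lintegral_compProd (hHz z)]
  · refine Measurable.aemeasurable ?_
    refine measurable_from_prod_countable_left (f := Function.uncurry fun η z =>
      ∫⁻ ζ, H (η + atom x, ζ + atom z) ∂(irwKernel p t η)) fun z => ?_
    exact (hHz z).lintegral_kernel_prod_right'

end Stationarity

/-! ### Charlier polynomials of configurations. -/

section CharlierD

variable {d : ℕ} {ρ : ℝ≥0}

/-- Adding one particle at a time matches the raising recursion `charlierD_add_single`. -/
theorem finConfig_induction {P : FinConfig d → Prop} (zero : P 0)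
    (add : ∀ ξ x, P ξ → P (ξ + Finsupp.single x 1)) (ξ : FinConfig d) : P ξ := by
  induction hn : ξ.degree generalizing ξ with
  | zero => rw [(Finsupp.degree_eq_zero_iff ξ).1 hn]; exact zero
  | succ n ih =>
    have hne : ξ ≠ 0 := by rintro rfl; simp at hn
    obtain ⟨x, hx⟩ := Finsupp.ne_iff.1 hne
    have hle : Finsupp.single x 1 ≤ ξ := by
      simpa using Nat.one_le_iff_ne_zero.2 hx
    have e : ξ - Finsupp.single x 1 + Finsupp.single x 1 = ξ := tsub_add_cancel_of_le hle
    rw [← e]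
    refine add _ _ (ih _ ?_)
    have := congrArg Finsupp.degree e
    rw [map_add, Finsupp.degree_single] at this
    lia

@[simp] theorem charlierD_zero (η : Config d) : charlierD ρ 0 η = 1 := by
  simp [charlierD]

theorem charlierD_erase (ξ : FinConfig d) (x : Site d) (η : Config d) :
    charlierD ρ ξ η = charlier ρ (ξ x) (η x) * charlierD ρ (ξ.erase x) η :=
  (Finsupp.mul_prod_erase' ξ x (fun x k => charlier ρ k (η x)) (by simp)).symm

theorem charlierD_congr {ξ : FinConfig d} {η ζ : Config d} (h : ∀ x, ξ x ≠ 0 → η x = ζ x) :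
    charlierD ρ ξ η = charlierD ρ ξ ζ :=
  Finset.prod_congr rfl fun x hx => by
    simp only [h x (Finsupp.mem_support_iff.1 hx)]

theorem charlierD_erase_congr (ξ : FinConfig d) {x : Site d} {η ζ : Config d}
    (h : ∀ y, y ≠ x → η y = ζ y) :
    charlierD ρ (ξ.erase x) η = charlierD ρ (ξ.erase x) ζ :=
  charlierD_congr fun y hy => h y fun e => hy (by rw [e, Finsupp.erase_same])

theorem charlierD_add_single (ξ : FinConfig d) (x : Site d) (η : Config d) :
    charlierD ρ (ξ + Finsupp.single x 1) η =
      charlierD ρ ξ η - (η x : ℝ) / ρ * charlierD ρ ξ (η - atom x) := by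
  have e : (ξ + Finsupp.single x 1).erase x = ξ.erase x := by
    ext y; by_cases h : y = x
    · subst h; simp
    · simp [Finsupp.erase_ne h]
  rw [charlierD_erase _ x, e, charlierD_erase ξ x η, charlierD_erase ξ x (η - atom x),
    charlierD_erase_congr ξ (x := x) (η := η - atom x) (ζ := η) (fun y hy => by simp [hy])]
  simp only [Finsupp.add_apply, Finsupp.single_eq_same, charlier_succ_left, Pi.sub_apply,
    atom_apply, if_true]
  ring

/-- Adding a particle to `η` lowers `ξ`, the dual of the previous recursion. If `ξ x = 0` the
truncated difference carries the coefficient `0`. -/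
theorem charlierD_add_atom (ξ : FinConfig d) (x : Site d) (η : Config d) :
    charlierD ρ ξ (η + atom x) =
      charlierD ρ ξ η - (ξ x : ℝ) / ρ * charlierD ρ (ξ - Finsupp.single x 1) η := by
  have e : (ξ - Finsupp.single x 1).erase x = ξ.erase x := by
    ext y; by_cases h : y = x
    · subst h; simp
    · simp [Finsupp.erase_ne h, h]
  rw [charlierD_erase (ξ - _) x, e, charlierD_erase ξ x η, charlierD_erase ξ x (η + atom x),
    charlierD_erase_congr ξ (x := x) (η := η + atom x) (ζ := η) (fun y hy => by simp [hy])]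
  simp only [Pi.add_apply, atom_apply, if_true, charlier_succ_right, Finsupp.tsub_apply,
    Finsupp.single_eq_same]
  ring

@[fun_prop]
theorem measurable_charlierD (ξ : FinConfig d) : Measurable (charlierD ρ ξ) := by
  unfold charlierD Finsupp.prod
  refine Finset.measurable_prod _ fun x _ => ?_
  exact (Measurable.of_discrete (f := charlier ρ (ξ x))).comp (measurable_pi_apply x)

/-- Independence of `η x` and a function that does not look at site `x`. -/
theorem lintegral_nu_mul (x : Site d) (g : ℕ → ℝ≥0∞) {R : Config d → ℝ≥0∞} (hR : Measurable R)
    (h : ∀ η n, R (Function.update η x n) = R η) :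
    ∫⁻ η, g (η x) * R η ∂(nu d ρ) = (∫⁻ n, g n ∂(poissonMeasure ρ)) * ∫⁻ η, R η ∂(nu d ρ) := by
  have hg : Measurable fun η : Config d => g (η x) :=
    (Measurable.of_discrete (f := g)).comp (measurable_pi_apply x)
  rw [lintegral_nu_update x (F := fun η => g (η x) * R η) (hg.mul hR)]
  simp only [Function.update_self, h]
  rw [← lintegral_const_mul _ hR]
  exact lintegral_congr fun η => lintegral_mul_const _ .of_discrete

theorem integrable_nu_mul (x : Site d) {g : ℕ → ℝ} (hg : Integrable g (poissonMeasure ρ))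
    {R : Config d → ℝ} (hRm : Measurable R) (hR : Integrable R (nu d ρ))
    (h : ∀ η n, R (Function.update η x n) = R η) :
    Integrable (fun η => g (η x) * R η) (nu d ρ) := by
  have hg' : Measurable fun η : Config d => g (η x) :=
    (Measurable.of_discrete (f := g)).comp (measurable_pi_apply x)
  refine ⟨(hg'.mul hRm).aestronglyMeasurable, ?_⟩
  rw [HasFiniteIntegral]
  simp only [enorm_mul]
  rw [lintegral_nu_mul x (fun n => ‖g n‖ₑ) hRm.enorm (fun η n => by rw [h])]
  exact ENNReal.mul_lt_top hg.2 hR.2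

theorem memLp_charlierD (ξ : FinConfig d) : MemLp (charlierD ρ ξ) 2 (nu d ρ) := by
  rw [memLp_two_iff_integrable_sq (measurable_charlierD ξ).aestronglyMeasurable]
  induction ξ using Finsupp.induction with
  | zero => simp
  | single_add a b f ha hb ih =>
    have hfa : f a = 0 := Finsupp.notMem_support_iff.1 ha
    have e : (Finsupp.single a b + f).erase a = f := by
      ext y; by_cases h : y = a
      · subst h; simp [hfa]
      · simp [Finsupp.erase_ne h]
    have h1 : ∀ η : Config d, charlierD ρ (Finsupp.single a b + f) η ^ 2 =
        charlier ρ b (η a) ^ 2 * charlierD ρ f η ^ 2 := by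
      intro η
      rw [charlierD_erase _ a, e]
      simp [hfa, mul_pow]
    simp_rw [h1]
    refine integrable_nu_mul a (g := fun n => charlier ρ b n ^ 2) (memLp_charlier ρ b).integrable_sq
      ((measurable_charlierD f).pow_const 2) ih fun η n => ?_
    congr 1
    refine charlierD_congr fun y hy => ?_
    have : y ≠ a := fun h => hy (h ▸ hfa)
    simp [this]

end CharlierD

/-! ### Pairings of Charlier polynomials under a Mecke coupling. -/

section Pairing

variable {d : ℕ} {ρ : ℝ≥0}

/-- `J` is a coupling of `ν_ρ` with itself in which a particle added at `x` on the left adds a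
particle with law `w x` on the right. -/
structure IsMeckeCoupling (ρ : ℝ≥0) (w : Site d → PMF (Site d))
    (J : Measure (Config d × Config d)) : Prop where
  fst : MeasurePreserving Prod.fst J (nu d ρ)
  snd : MeasurePreserving Prod.snd J (nu d ρ)
  mecke : ∀ (x : Site d) (H : Config d × Config d → ℝ≥0∞), Measurable H →
    ∫⁻ q, q.1 x * H q ∂J =
      ρ * ∫⁻ z, ∫⁻ q, H (q.1 + atom x, q.2 + atom z) ∂J ∂(w x).toMeasure

theorem isMeckeCoupling_jointLaw {p : Site d → PMF (Site d)} (hp : ∀ i j, p i j = p j i)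
    (t : ℝ≥0) : IsMeckeCoupling ρ (walkLaw p t) (jointLaw p t ρ) :=
  ⟨measurePreserving_fst_jointLaw, measurePreserving_snd_jointLaw hp,
    fun x _ hH => lintegral_jointLaw_mecke hp x hH⟩

/-- Walkers that do not move: the general recursion specializes to the orthogonality relations under
`ν_ρ`. -/
theorem isMeckeCoupling_diag :
    IsMeckeCoupling ρ PMF.pure ((nu d ρ).map fun η => (η, η)) := by
  have hm : Measurable fun η : Config d => (η, η) := by fun_prop
  refine ⟨⟨measurable_fst, ?_⟩, ⟨measurable_snd, ?_⟩, fun x H hH => ?_⟩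
  · rw [Measure.map_map measurable_fst hm]; exact Measure.map_id
  · rw [Measure.map_map measurable_snd hm]; exact Measure.map_id
  · have h1 : Measurable fun q : Config d × Config d => (q.1 x : ℝ≥0∞) :=
      (measurable_eval_cast x).comp measurable_fst
    rw [lintegral_map (f := fun q : Config d × Config d => (q.1 x : ℝ≥0∞) * H q) (h1.mul hH) hm, PMF.toMeasure_pure, lintegral_dirac,
      lintegral_map (by fun_prop) hm]
    exact lintegral_nu_mecke x (hH.comp hm)

variable {w : Site d → PMF (Site d)} {J : Measure (Config d × Config d)}

theorem IsMeckeCoupling.isProbabilityMeasure (hJ : IsMeckeCoupling ρ w J) :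
    IsProbabilityMeasure J := by
  refine ⟨?_⟩
  rw [← Set.preimage_univ (f := Prod.fst), hJ.fst.measure_preimage nullMeasurableSet_univ,
    measure_univ]

theorem measurable_atom_coupling (x : Site d) :
    Measurable fun r : Site d × (Config d × Config d) => (r.2.1 + atom x, r.2.2 + atom r.1) := by
  have h : Measurable fun r : Site d × (Config d × Config d) => r.2.2 + atom r.1 :=
    measurable_add_atom_prod.comp (measurable_fst.prodMk (measurable_snd.comp measurable_snd))
  exact Measurable.prodMk (by fun_prop) h

/-- The Mecke equation as an identity of measures, through which integrability and signed integrands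
are transferred. -/
theorem IsMeckeCoupling.withDensity_eq (hJ : IsMeckeCoupling ρ w J) (x : Site d) :
    J.withDensity (fun q => ((q.1 x : ℝ≥0) : ℝ≥0∞)) =
      (ρ : ℝ≥0∞) • ((w x).toMeasure.prod J).map
        fun r : Site d × (Config d × Config d) => (r.2.1 + atom x, r.2.2 + atom r.1) := by
  have := hJ.isProbabilityMeasure
  have h1 : Measurable fun q : Config d × Config d => ((q.1 x : ℝ≥0) : ℝ≥0∞) := by
    simpa [Function.comp_def] using (measurable_eval_cast x).comp
      (measurable_fst (α := Config d) (β := Config d))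
  refine Measure.ext_of_lintegral _ fun H hH => ?_
  rw [lintegral_withDensity_eq_lintegral_mul _ h1 hH, lintegral_smul_measure,
    lintegral_map hH (measurable_atom_coupling x),
    lintegral_prod (f := fun r : Site d × (Config d × Config d) =>
      H (r.2.1 + atom x, r.2.2 + atom r.1)) (hH.comp (measurable_atom_coupling x)).aemeasurable]
  simpa using hJ.mecke x H hH

theorem IsMeckeCoupling.integrable_comp (hJ : IsMeckeCoupling ρ w J) (hρ : 0 < ρ) (x : Site d)
    {H : Config d × Config d → ℝ} (hH : Measurable H)
    (hi : Integrable (fun q => (q.1 x : ℝ) * H q) J) :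
    Integrable (fun r : Site d × (Config d × Config d) => H (r.2.1 + atom x, r.2.2 + atom r.1))
      ((w x).toMeasure.prod J) := by
  have := hJ.isProbabilityMeasure
  have hd : Measurable fun q : Config d × Config d => (q.1 x : ℝ≥0) :=
    (Measurable.of_discrete (f := fun n : ℕ => (n : ℝ≥0))).comp
      ((measurable_pi_apply x).comp measurable_fst)
  have h2 : Integrable H (J.withDensity (fun q => ((q.1 x : ℝ≥0) : ℝ≥0∞))) := by
    rw [integrable_withDensity_iff_integrable_smul hd]
    simpa [NNReal.smul_def] using hi
  rw [hJ.withDensity_eq x, integrable_smul_measure (by simpa using hρ.ne') (by simp),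
    integrable_map_measure hH.aestronglyMeasurable (measurable_atom_coupling x).aemeasurable] at h2
  exact h2

theorem IsMeckeCoupling.integral_mecke (hJ : IsMeckeCoupling ρ w J) (hρ : 0 < ρ) (x : Site d)
    {H : Config d × Config d → ℝ} (hH : Measurable H)
    (hi : Integrable (fun q => (q.1 x : ℝ) * H q) J) :
    ∫ q, (q.1 x : ℝ) * H q ∂J =
      ρ * ∫ z, ∫ q, H (q.1 + atom x, q.2 + atom z) ∂J ∂(w x).toMeasure := by
  have := hJ.isProbabilityMeasure
  have hd : Measurable fun q : Config d × Config d => (q.1 x : ℝ≥0) :=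
    (Measurable.of_discrete (f := fun n : ℕ => (n : ℝ≥0))).comp
      ((measurable_pi_apply x).comp measurable_fst)
  have h2 := integral_withDensity_eq_integral_smul (μ := J) hd H
  rw [hJ.withDensity_eq x, integral_smul_measure, integral_map
    (measurable_atom_coupling x).aemeasurable hH.aestronglyMeasurable,
    integral_prod _ (hJ.integrable_comp hρ x hH hi)] at h2
  simpa [NNReal.smul_def] using h2.symm

variable (ρ J) in
/-- The expectation of `D(ξ,·)` at the left times `D(ξ',·)` at the right under a coupling. -/
def pairing (ξ ξ' : FinConfig d) : ℝ := ∫ q, charlierD ρ ξ q.1 * charlierD ρ ξ' q.2 ∂J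

theorem IsMeckeCoupling.integrable_charlierD (hJ : IsMeckeCoupling ρ w J) (ξ ξ' : FinConfig d) :
    Integrable (fun q => charlierD ρ ξ q.1 * charlierD ρ ξ' q.2) J :=
  ((memLp_charlierD ξ).comp_measurePreserving hJ.fst).integrable_mul
    ((memLp_charlierD ξ').comp_measurePreserving hJ.snd)

/-- The raising recursion expresses `η x * D(ξ, η - atom x)` through `D(ξ,·)` and `D(ξ + δ_x,·)`, so
the pairing appears on the left of the Mecke equation. On the right the added particle at `x`
cancels the removed one, while the one at `z` lowers `ξ'`. The terms with `D(ξ,·) D(ξ',·)` cancel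
because `w x` has mass one. -/
theorem IsMeckeCoupling.pairing_add_single (hJ : IsMeckeCoupling ρ w J) (hρ : 0 < ρ)
    (ξ ξ' : FinConfig d) (x : Site d) :
    pairing ρ J (ξ + Finsupp.single x 1) ξ' =
      ∑ z ∈ ξ'.support, (w x z).toReal *
        ((ξ' z : ℝ) / ρ * pairing ρ J ξ (ξ' - Finsupp.single z 1)) := by
  have := hJ.isProbabilityMeasure
  have hρ' : (ρ : ℝ) ≠ 0 := by exact_mod_cast hρ.ne'
  -- The truncated `q.1 - atom x` is only used under the factor `q.1 x`, which vanishes when there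
  -- is nothing to remove.
  set H : Config d × Config d → ℝ := fun q => charlierD ρ ξ (q.1 - atom x) * charlierD ρ ξ' q.2
    with hHdef
  have hsub : Measurable fun η : Config d => η - atom x := by fun_prop
  have hH : Measurable H := by
    have h1 : Measurable fun q : Config d × Config d => charlierD ρ ξ (q.1 - atom x) :=
      (measurable_charlierD ξ).comp (hsub.comp measurable_fst)
    exact h1.mul ((measurable_charlierD ξ').comp measurable_snd)
  have h1 : ∀ q : Config d × Config d, (q.1 x : ℝ) * H q = ρ * (charlierD ρ ξ q.1 *
      charlierD ρ ξ' q.2 - charlierD ρ (ξ + Finsupp.single x 1) q.1 * charlierD ρ ξ' q.2) := by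
    intro q
    rw [charlierD_add_single, hHdef]
    field_simp
    ring
  have hi : Integrable (fun q => (q.1 x : ℝ) * H q) J := by
    simp_rw [h1]
    exact ((hJ.integrable_charlierD _ _).sub (hJ.integrable_charlierD _ _)).const_mul _
  have h2 := hJ.integral_mecke hρ x hH hi
  simp_rw [h1] at h2
  rw [integral_const_mul, integral_sub (hJ.integrable_charlierD _ _) (hJ.integrable_charlierD _ _)]
    at h2
  have h3 : ∀ z, ∫ q, H (q.1 + atom x, q.2 + atom z) ∂J =
      pairing ρ J ξ ξ' - (ξ' z : ℝ) / ρ * pairing ρ J ξ (ξ' - Finsupp.single z 1) := by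
    intro z
    have : ∀ q : Config d × Config d, H (q.1 + atom x, q.2 + atom z) =
        charlierD ρ ξ q.1 * charlierD ρ ξ' q.2 - (ξ' z : ℝ) / ρ *
          (charlierD ρ ξ q.1 * charlierD ρ (ξ' - Finsupp.single z 1) q.2) := by
      intro q
      simp only [hHdef, add_tsub_cancel_right, charlierD_add_atom]
      ring
    simp_rw [this]
    rw [integral_sub (hJ.integrable_charlierD _ _) ((hJ.integrable_charlierD _ _).const_mul _),
      integral_const_mul]
    rfl
  simp_rw [h3] at h2
  have hfin : Set.Finite (Function.support fun z : Site d =>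
      (ξ' z : ℝ) / ρ * pairing ρ J ξ (ξ' - Finsupp.single z 1)) := by
    refine ξ'.support.finite_toSet.subset fun z hz => ?_
    simp only [Function.mem_support, ne_eq, mul_eq_zero, not_or, div_eq_zero_iff] at hz
    simpa using hz.1.1
  have hint : Integrable (fun z : Site d =>
      (ξ' z : ℝ) / ρ * pairing ρ J ξ (ξ' - Finsupp.single z 1)) (w x).toMeasure := by
    obtain ⟨C, hC⟩ := (hfin.image fun z : Site d => ‖(ξ' z : ℝ) / ρ *
      pairing ρ J ξ (ξ' - Finsupp.single z 1)‖).bddAbove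
    refine Integrable.of_bound (C := max C 0) Measurable.of_discrete.aestronglyMeasurable
      (.of_forall fun z => ?_)
    by_cases hz : z ∈ Function.support fun z : Site d =>
      (ξ' z : ℝ) / ρ * pairing ρ J ξ (ξ' - Finsupp.single z 1)
    · exact (hC ⟨z, hz, rfl⟩).trans (le_max_left _ _)
    · rw [Function.notMem_support.1 hz]; simp
  rw [integral_sub (integrable_const _) hint, PMF.integral_eq_tsum _ _ hint,
    tsum_eq_sum (s := ξ'.support)] at h2
  · simp only [integral_const, probReal_univ, smul_eq_mul] at h2
    have h4 := mul_left_cancel₀ hρ' h2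
    unfold pairing at h4 ⊢
    linarith
  · intro z hz
    rw [Finsupp.notMem_support_iff.1 hz]; simp

/-- Orthogonality of the Charlier polynomials. -/
theorem integral_charlierD_mul_add_single (hρ : 0 < ρ) (ξ ξ' : FinConfig d) (x : Site d) :
    ∫ η, charlierD ρ (ξ + Finsupp.single x 1) η * charlierD ρ ξ' η ∂(nu d ρ) =
      (ξ' x : ℝ) / ρ *
        ∫ η, charlierD ρ ξ η * charlierD ρ (ξ' - Finsupp.single x 1) η ∂(nu d ρ) := by
  have h : ∀ ξ ξ' : FinConfig d, pairing ρ ((nu d ρ).map fun η => (η, η)) ξ ξ' =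
      ∫ η, charlierD ρ ξ η * charlierD ρ ξ' η ∂(nu d ρ) := by
    intro ξ ξ'
    rw [pairing, integral_map (by fun_prop)]
    exact (isMeckeCoupling_diag.integrable_charlierD ξ ξ').aestronglyMeasurable
  have h2 := isMeckeCoupling_diag.pairing_add_single hρ ξ ξ' x
  rw [h] at h2
  simp_rw [h] at h2
  rw [h2, Finset.sum_eq_single x]
  · simp
  · intro z _ hz
    simp [PMF.pure_apply, hz]
  · intro hx
    simp [Finsupp.notMem_support_iff.1 hx]

/-- Lower both configurations at the same site: either the second has no particle there and the
coefficient is `0`, or they remain different. The induction ends when the first is empty. -/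
theorem integral_charlierD_mul_of_ne (hρ : 0 < ρ) {ξ ξ' : FinConfig d} (h : ξ ≠ ξ') :
    ∫ η, charlierD ρ ξ η * charlierD ρ ξ' η ∂(nu d ρ) = 0 := by
  induction ξ using finConfig_induction generalizing ξ' with
  | zero =>
    induction ξ' using finConfig_induction with
    | zero => exact absurd rfl h
    | add ξ' x _ =>
      simp_rw [mul_comm (charlierD ρ 0 _)]
      rw [integral_charlierD_mul_add_single hρ]
      simp
  | add ξ x ih =>
    rw [integral_charlierD_mul_add_single hρ]
    by_cases hx : ξ' x = 0
    · simp [hx]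
    · rw [ih, mul_zero]
      rintro rfl
      refine h (tsub_add_cancel_of_le ?_)
      simpa using Nat.one_le_iff_ne_zero.2 hx

theorem normSq_eq (ξ : FinConfig d) :
    normSq ρ ξ = ∫ η, charlierD ρ ξ η * charlierD ρ ξ η ∂(nu d ρ) := by
  simp_rw [normSq, pow_two]

@[simp] theorem normSq_zero : normSq ρ (0 : FinConfig d) = 1 := by simp [normSq]

theorem normSq_add_single (hρ : 0 < ρ) (ξ : FinConfig d) (x : Site d) :
    normSq ρ (ξ + Finsupp.single x 1) = ((ξ x : ℝ) + 1) / ρ * normSq ρ ξ := by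
  rw [normSq_eq, integral_charlierD_mul_add_single hρ, normSq_eq]
  simp

theorem normSq_pos (hρ : 0 < ρ) (ξ : FinConfig d) : 0 < normSq ρ ξ := by
  have hρ' : (0 : ℝ) < ρ := hρ
  induction ξ using finConfig_induction with
  | zero => simp
  | add ξ x ih =>
    rw [normSq_add_single hρ]
    positivity

/-- The coefficients `W_n`, a bound for the probability that `n` independent particles end up
in a given configuration. -/
def occBound (q : ℝ) : ℕ → ℝ
  | 0 => 1
  | n + 1 => min 1 ((n + 1) * q) * occBound q n

theorem occBound_nonneg {q : ℝ} (hq : 0 ≤ q) (n : ℕ) : 0 ≤ occBound q n := by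
  induction n with
  | zero => simp [occBound]
  | succ n ih => rw [occBound]; positivity

/-- The reason for the minimum with `1` in the definition: the bound for `k` particles holds for
every larger number, whereas `n! q ^ n` alone would not be uniform in `n`. -/
theorem occBound_antitone {q : ℝ} (hq : 0 ≤ q) : Antitone (occBound q) :=
  antitone_nat_of_succ_le fun n => by
    rw [occBound]
    exact mul_le_of_le_one_left (occBound_nonneg hq n) (min_le_left _ _)

theorem occBound_le {q : ℝ} (hq : 0 ≤ q) (n : ℕ) : occBound q n ≤ n.factorial * q ^ n := by
  induction n with
  | zero => simp [occBound]
  | succ n ih =>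
    rw [occBound, Nat.factorial_succ, pow_succ]
    calc _ ≤ ((n + 1) * q) * (n.factorial * q ^ n) := by
          gcongr
          · exact occBound_nonneg hq n
          · exact min_le_right _ _
      _ = _ := by push_cast; ring

/-- The pairing vanishes for different numbers of particles and is small for equal ones. -/
theorem IsMeckeCoupling.abs_pairing_le (hJ : IsMeckeCoupling ρ w J) (hρ : 0 < ρ) {q : ℝ}
    (hq : ∀ x z, (w x z).toReal ≤ q) (ξ ξ' : FinConfig d) :
    |pairing ρ J ξ ξ'| ≤
      if ξ.degree = ξ'.degree then occBound q ξ.degree * normSq ρ ξ' else 0 := by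
  have hρ' : (0 : ℝ) < ρ := hρ
  have hq0 : 0 ≤ q := ENNReal.toReal_nonneg.trans (hq 0 0)
  induction ξ using finConfig_induction generalizing ξ' with
  | zero =>
    have : pairing ρ J 0 ξ' = ∫ η, charlierD ρ 0 η * charlierD ρ ξ' η ∂(nu d ρ) := by
      simp only [pairing, charlierD_zero, one_mul]
      rw [← hJ.snd.map_eq, integral_map hJ.snd.measurable.aemeasurable
        (measurable_charlierD ξ').aestronglyMeasurable]
    rw [this]
    by_cases h : 0 = ξ'
    · subst h
      simp [occBound]
    · rw [integral_charlierD_mul_of_ne hρ h, abs_zero]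
      split_ifs
      · exact mul_nonneg (occBound_nonneg hq0 _) (normSq_pos hρ _).le
      · exact le_rfl
  | add ξ x ih =>
    rw [hJ.pairing_add_single hρ, map_add, Finsupp.degree_single]
    have hdeg : ∀ z ∈ ξ'.support, (ξ' - Finsupp.single z 1).degree + 1 = ξ'.degree ∧
        (ξ' z : ℝ) / ρ * normSq ρ (ξ' - Finsupp.single z 1) = normSq ρ ξ' := by
      intro z hz
      have hz' := Finsupp.mem_support_iff.1 hz
      have e : ξ' - Finsupp.single z 1 + Finsupp.single z 1 = ξ' :=
        tsub_add_cancel_of_le (by simpa using Nat.one_le_iff_ne_zero.2 hz')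
      constructor
      · conv_rhs => rw [← e]
        rw [map_add, Finsupp.degree_single]
      · conv_rhs => rw [← e]
        rw [normSq_add_single hρ]
        have : (((ξ' - Finsupp.single z 1 : FinConfig d) z : ℕ) : ℝ) + 1 = ξ' z := by
          have := DFunLike.congr_fun e z
          simp only [Finsupp.add_apply, Finsupp.single_eq_same] at this
          exact_mod_cast this
        rw [this]
    have hterm : ∀ z ∈ ξ'.support, |(w x z).toReal *
        ((ξ' z : ℝ) / ρ * pairing ρ J ξ (ξ' - Finsupp.single z 1))| ≤
        if ξ.degree + 1 = ξ'.degree then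
          (w x z).toReal * (occBound q ξ.degree * normSq ρ ξ') else 0 := by
      intro z hz
      obtain ⟨h1, h2⟩ := hdeg z hz
      have h3 := ih (ξ' - Finsupp.single z 1)
      rw [abs_mul, abs_mul, abs_of_nonneg ENNReal.toReal_nonneg, abs_of_nonneg
        (show (0 : ℝ) ≤ ξ' z / ρ by positivity)]
      split_ifs with hd
      · rw [if_pos (by lia)] at h3
        refine mul_le_mul_of_nonneg_left ?_ ENNReal.toReal_nonneg
        rw [← h2]
        calc _ ≤ (ξ' z : ℝ) / ρ * (occBound q ξ.degree * normSq ρ (ξ' - Finsupp.single z 1)) := by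
              gcongr
          _ = _ := by ring
      · rw [if_neg (by lia)] at h3
        rw [abs_nonpos_iff.1 h3]
        simp
    refine (Finset.abs_sum_le_sum_abs _ _).trans ((Finset.sum_le_sum hterm).trans ?_)
    split_ifs with hd
    · rw [← Finset.sum_mul, occBound, mul_assoc]
      -- The mass of `w x` on the support of `ξ'` is at most its total mass `1`. It is also at most
      -- `q` per site, and there are no more sites than particles in `ξ'`, that is, `‖ξ‖ + 1`.
      refine mul_le_mul_of_nonneg_right (le_min ?_ ?_)
        (mul_nonneg (occBound_nonneg hq0 _) (normSq_pos hρ _).le)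
      · have h1 : ∑ z ∈ ξ'.support, w x z ≤ 1 := by
          rw [← (w x).tsum_coe]; exact ENNReal.sum_le_tsum _
        rw [← ENNReal.toReal_sum fun z _ => PMF.apply_ne_top _ _]
        exact ENNReal.toReal_le_of_le_ofReal zero_le_one (by simpa using h1)
      · have hcard : ξ'.support.card ≤ ξ'.degree := by
          rw [Finsupp.degree_apply]
          calc ξ'.support.card = ∑ z ∈ ξ'.support, 1 := by simp
            _ ≤ _ := Finset.sum_le_sum fun z hz =>
              Nat.one_le_iff_ne_zero.2 (Finsupp.mem_support_iff.1 hz)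
        calc _ ≤ ∑ z ∈ ξ'.support, q := Finset.sum_le_sum fun z _ => hq x z
          _ = ξ'.support.card * q := by simp
          _ ≤ (ξ.degree + 1) * q := by
            gcongr
            rw [← hd] at hcard
            exact_mod_cast hcard
    · simp

end Pairing

/-! ### Completeness of the Charlier polynomials in `L²(ν_ρ)`. -/

section Completeness

theorem sq_integral_mul_le {α : Type*} [MeasurableSpace α] {μ : Measure α} {f g : α → ℝ}
    (hf : MemLp f 2 μ) (hg : MemLp g 2 μ) :
    (∫ a, f a * g a ∂μ) ^ 2 ≤ (∫ a, f a ^ 2 ∂μ) * ∫ a, g a ^ 2 ∂μ := by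
  have h : ∀ {u v : α → ℝ} (hu : MemLp u 2 μ) (hv : MemLp v 2 μ),
      inner ℝ (hu.toLp u) (hv.toLp v) = ∫ a, u a * v a ∂μ := by
    intro u v hu hv
    rw [L2.inner_def]
    refine integral_congr_ae ?_
    filter_upwards [hu.coeFn_toLp, hv.coeFn_toLp] with a h1 h2
    simp [h1, h2, mul_comm]
  have := real_inner_mul_inner_self_le (hf.toLp f) (hg.toLp g)
  simpa only [h, pow_two] using this

variable {d : ℕ} {ρ : ℝ≥0}

theorem charlierD_single (x : Site d) (k : ℕ) (η : Config d) :
    charlierD ρ (Finsupp.single x k) η = charlier ρ k (η x) := by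
  simp [charlierD]

theorem integral_nu_eval (x : Site d) (g : ℕ → ℝ) :
    ∫ η, g (η x) ∂(nu d ρ) = ∫ n, g n ∂(poissonMeasure ρ) := by
  have h := measurePreserving_eval_infinitePi (fun _ : Site d => poissonMeasure ρ) x
  rw [← h.map_eq, integral_map h.measurable.aemeasurable Measurable.of_discrete.aestronglyMeasurable]
  rfl

theorem integral_charlier_mul (hρ : 0 < ρ) (k l : ℕ) :
    ∫ n, charlier ρ k n * charlier ρ l n ∂(poissonMeasure ρ) =
      if k = l then (k.factorial : ℝ) / ρ ^ k else 0 := by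
  -- The lattice with `d = 0` has a single site, so the one-site relations are a case of those for
  -- configurations.
  rw [← integral_nu_eval (d := 0) 0 fun n => charlier ρ k n * charlier ρ l n]
  simp_rw [← charlierD_single]
  split_ifs with h
  · subst h
    rw [← normSq_eq]
    induction k with
    | zero => simp
    | succ k ih =>
      rw [Finsupp.single_add, normSq_add_single hρ, ih, Finsupp.single_eq_same, Nat.factorial_succ,
        pow_succ]
      push_cast
      field_simp
  · exact integral_charlierD_mul_of_ne hρ fun e => h (Finsupp.single_injective _ e)

/-- The remainder in the Charlier expansion of the indicator of `{m}`. -/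
def charlierRem (ρ : ℝ≥0) (m K n : ℕ) : ℝ :=
  (if n = m then 1 else 0) - ∑ k ∈ Finset.range K,
    ((poissonMeasure ρ).real {m} * charlier ρ k m * ρ ^ k / k.factorial) * charlier ρ k n

theorem memLp_charlierRem (m K : ℕ) : MemLp (charlierRem ρ m K) 2 (poissonMeasure ρ) := by
  refine MemLp.sub ?_ (memLp_finsetSum _ fun k _ => (memLp_charlier ρ k).const_mul _)
  refine MemLp.of_bound Measurable.of_discrete.aestronglyMeasurable 1 (.of_forall fun n => ?_)
  split_ifs <;> simp

theorem integral_ite_eq_mul (m : ℕ) (g : ℕ → ℝ) :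
    ∫ n, (if n = m then 1 else 0) * g n ∂(poissonMeasure ρ) =
      (poissonMeasure ρ).real {m} * g m := by
  have : ∀ n, (if n = m then 1 else 0) * g n = ({m} : Set ℕ).indicator (fun _ => g m) n := by
    intro n
    by_cases h : n = m <;> simp [h]
  simp_rw [this]
  rw [integral_indicator_const _ (measurableSet_singleton m), smul_eq_mul]

/-- Pythagoras: `charlierRem` subtracts from the indicator of `{m}`, whose squared norm is its
Poisson weight `π`, its projection on the first `K` polynomials. The coefficients use `⟨1_m, d(k,·)⟩
= π d(k,m)` and `‖d(k,·)‖² = k! / ρ ^ k`. -/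
theorem integral_charlierRem_sq (hρ : 0 < ρ) (m K : ℕ) :
    ∫ n, charlierRem ρ m K n ^ 2 ∂(poissonMeasure ρ) =
      (poissonMeasure ρ).real {m} - ∑ k ∈ Finset.range K,
        ((poissonMeasure ρ).real {m}) ^ 2 * charlier ρ k m ^ 2 * ρ ^ k / k.factorial := by
  set π := (poissonMeasure ρ).real {m} with hπ
  have hρ' : (ρ : ℝ) ≠ 0 := by exact_mod_cast hρ.ne'
  set I : ℕ → ℝ := fun n => if n = m then 1 else 0 with hI
  have mI : MemLp I 2 (poissonMeasure ρ) := by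
    refine MemLp.of_bound Measurable.of_discrete.aestronglyMeasurable 1 (.of_forall fun n => ?_)
    simp only [hI]; split_ifs <;> simp
  have m1 : ∀ k, ∫ n, charlierRem ρ m K n * charlier ρ k n ∂(poissonMeasure ρ) =
      if k < K then 0 else π * charlier ρ k m := by
    intro k
    have : ∀ n, charlierRem ρ m K n * charlier ρ k n = I n * charlier ρ k n -
        ∑ j ∈ Finset.range K, (π * charlier ρ j m * ρ ^ j / j.factorial) *
          (charlier ρ j n * charlier ρ k n) := by
      intro n
      rw [charlierRem, sub_mul, Finset.sum_mul]
      congr 1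
      exact Finset.sum_congr rfl fun j _ => by ring
    simp_rw [this]
    have hij : ∀ j, Integrable (fun n => charlier ρ j n * charlier ρ k n) (poissonMeasure ρ) :=
      fun j => (memLp_charlier ρ j).integrable_mul (memLp_charlier ρ k)
    rw [integral_sub (f := fun n => I n * charlier ρ k n) (mI.integrable_mul (memLp_charlier ρ k))
      (integrable_finsetSum _ fun j _ => (hij j).const_mul _),
      integral_finsetSum _ fun j _ => (hij j).const_mul _]
    simp_rw [integral_const_mul, integral_charlier_mul hρ]
    rw [integral_ite_eq_mul]
    split_ifs with hk
    · rw [Finset.sum_eq_single_of_mem k (Finset.mem_range.2 hk) fun j _ hj => by simp [hj]]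
      rw [if_pos rfl, ← hπ]
      field_simp
      ring
    · rw [Finset.sum_eq_zero fun j hj => ?_, sub_zero]
      have : j ≠ k := by have := Finset.mem_range.1 hj; lia
      simp [this]
  have m2 : ∀ n, charlierRem ρ m K n ^ 2 = I n * charlierRem ρ m K n -
      ∑ j ∈ Finset.range K, (π * charlier ρ j m * ρ ^ j / j.factorial) *
          (charlierRem ρ m K n * charlier ρ j n) := by
    intro n
    conv_lhs => rw [pow_two]; enter [1]; rw [charlierRem]
    rw [sub_mul, Finset.sum_mul]
    congr 1
    exact Finset.sum_congr rfl fun j _ => by ring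
  simp_rw [m2]
  have hij : ∀ j, Integrable (fun n => charlierRem ρ m K n * charlier ρ j n) (poissonMeasure ρ) :=
      fun j => (memLp_charlierRem m K).integrable_mul (memLp_charlier ρ j)
  rw [integral_sub (f := fun n => I n * charlierRem ρ m K n)
      (mI.integrable_mul (memLp_charlierRem m K))
      (integrable_finsetSum _ fun j _ => (hij j).const_mul _),
      integral_finsetSum _ fun j _ => (hij j).const_mul _]
  simp_rw [integral_const_mul, m1]
  rw [integral_ite_eq_mul, Finset.sum_eq_zero fun j hj => by simp [Finset.mem_range.1 hj], sub_zero,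
    charlierRem, if_pos rfl, mul_sub, mul_one, Finset.mul_sum, hπ]
  congr 1
  exact Finset.sum_congr rfl fun j _ => by ring

/-- Charlier polynomials are complete on one site; this follows from their self-duality. -/
theorem tendsto_integral_charlierRem_sq (hρ : 0 < ρ) (m : ℕ) :
    Filter.Tendsto (fun K => ∫ n, charlierRem ρ m K n ^ 2 ∂(poissonMeasure ρ))
      Filter.atTop (𝓝 0) := by
  simp_rw [integral_charlierRem_sq hρ]
  set π := (poissonMeasure ρ).real {m} with hπ
  have hρ' : (ρ : ℝ) ≠ 0 := by exact_mod_cast hρ.ne'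
  -- By self-duality `∑ k, d(k,m)² ρ^k / k!` is `exp ρ` times the squared norm of `d(m,·)`, that is
  -- `exp ρ * m! / ρ ^ m = 1 / π`. So Bessel's inequality for the indicator is an equality.
  have h := (hasSum_integral_poissonMeasure (memLp_charlier ρ m).integrable_sq).mul_left
    (π ^ 2 * Real.exp ρ)
  simp_rw [pow_two (charlier ρ m _), integral_charlier_mul hρ, if_true] at h
  have e1 : π ^ 2 * Real.exp ρ * (m.factorial / ρ ^ m) = π := by
    have : π * Real.exp ρ * (m.factorial / ρ ^ m) = 1 := by
      rw [hπ, poissonMeasure_real_singleton, Real.exp_neg]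
      field_simp
    calc _ = π * (π * Real.exp ρ * (m.factorial / ρ ^ m)) := by ring
      _ = _ := by rw [this, mul_one]
  rw [e1] at h
  have h2 := h.tendsto_sum_nat
  have := (tendsto_const_nhds (x := π)).sub h2
  rw [sub_self] at this
  refine this.congr fun K => ?_
  congr 1
  refine Finset.sum_congr rfl fun k _ => ?_
  rw [charlier_comm ρ m k, Real.exp_neg, smul_eq_mul]
  field_simp

/-- Induction on `F`, for all `ξ` vanishing there. The indicator at a new site `y` is a finite
Charlier sum plus a remainder. A Charlier factor at `y` only adds particles at `y` to `ξ`, so the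
sum contributes nothing by induction; the remainder is independent of the other sites and is made
small by Cauchy–Schwarz. -/
theorem integral_pi_indicator_mul_eq_zero (hρ : 0 < ρ) {h : Config d → ℝ}
    (hh : MemLp h 2 (nu d ρ)) (h0 : ∀ ξ, ∫ η, charlierD ρ ξ η * h η ∂(nu d ρ) = 0)
    (F : Finset (Site d)) (m : Site d → ℕ) (ξ : FinConfig d) (hξ : ∀ x ∈ F, ξ x = 0) :
    ∫ η, ((∏ x ∈ F, if η x = m x then 1 else 0) * charlierD ρ ξ η) * h η ∂(nu d ρ) = 0 := by
  induction F using Finset.induction_on generalizing ξ with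
  | empty => simpa using h0 ξ
  | insert y F hy ih =>
    have hξy : ξ y = 0 := hξ y (Finset.mem_insert_self _ _)
    have hmeas : ∀ (x : Site d) (g : ℕ → ℝ), Measurable fun η : Config d => g (η x) := fun x g =>
      (Measurable.of_discrete (f := g)).comp (measurable_pi_apply x)
    set Q : Config d → ℝ := fun η => ∏ x ∈ F, if η x = m x then 1 else 0 with hQ
    have hQm : Measurable Q := Finset.measurable_prod _ fun x _ =>
      hmeas x fun n => if n = m x then 1 else 0
    have hQ1 : ∀ η, |Q η| ≤ 1 := by
      intro η
      rw [hQ, Finset.abs_prod]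
      refine Finset.prod_le_one (fun _ _ => abs_nonneg _) fun x _ => ?_
      split_ifs <;> simp
    have hRL : ∀ ζ : FinConfig d, MemLp (fun η => Q η * charlierD ρ ζ η) 2 (nu d ρ) := fun ζ =>
      (memLp_charlierD ζ).mono (hQm.mul (measurable_charlierD ζ)).aestronglyMeasurable
        (.of_forall fun η => by
          rw [norm_mul]
          exact mul_le_of_le_one_left (norm_nonneg _) (hQ1 η))
    set R : Config d → ℝ := fun η => Q η * charlierD ρ ξ η with hR
    have hRm : Measurable R := hQm.mul (measurable_charlierD ξ)
    have hRy : ∀ η n, R (Function.update η y n) = R η := by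
      intro η n
      have h1 : ∀ x, x ≠ y → Function.update η y n x = η x := fun x hx => by simp [hx]
      simp only [hR, hQ]
      congr 1
      · refine Finset.prod_congr rfl fun x hx => ?_
        rw [h1 x fun e => hy (e ▸ hx)]
      · exact charlierD_congr fun x hx => h1 x fun e => hx (e ▸ hξy)
    have hsplit : ∀ k η, charlier ρ k (η y) * R η =
        Q η * charlierD ρ (ξ + Finsupp.single y k) η := by
      intro k η
      have e : (ξ + Finsupp.single y k).erase y = ξ := by
        ext x; by_cases h : x = y
        · subst h; simp [hξy]
        · simp [Finsupp.erase_ne h]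
      rw [charlierD_erase (ξ + _) y, e]
      simp only [hR, Finsupp.add_apply, hξy, Finsupp.single_eq_same, zero_add]
      ring
    have hprod : ∀ η : Config d, ((∏ x ∈ insert y F, if η x = m x then 1 else 0) *
        charlierD ρ ξ η) * h η = ((if η y = m y then 1 else 0) * R η) * h η := by
      intro η
      rw [Finset.prod_insert hy]
      simp only [hR, hQ]
      ring
    simp_rw [hprod]
    set A := ∫ η, ((if η y = m y then 1 else 0) * R η) * h η ∂(nu d ρ) with hA
    have hremL : ∀ K, MemLp (fun η => charlierRem ρ (m y) K (η y) * R η) 2 (nu d ρ) := by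
      intro K
      have hm : Measurable fun η => charlierRem ρ (m y) K (η y) * R η := (hmeas y _).mul hRm
      rw [memLp_two_iff_integrable_sq hm.aestronglyMeasurable]
      simp_rw [mul_pow]
      exact integrable_nu_mul y (g := fun n => charlierRem ρ (m y) K n ^ 2)
        (memLp_charlierRem (m y) K).integrable_sq (hRm.pow_const 2) (hRL ξ).integrable_sq
        fun η n => by rw [hRy]
    have hAK : ∀ K, A = ∫ η, (charlierRem ρ (m y) K (η y) * R η) * h η ∂(nu d ρ) := by
      intro K
      have e : ∀ η : Config d, ((if η y = m y then 1 else 0) * R η) * h η =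
          (charlierRem ρ (m y) K (η y) * R η) * h η + ∑ k ∈ Finset.range K,
            ((poissonMeasure ρ).real {m y} * charlier ρ k (m y) * ρ ^ k / k.factorial) *
              ((Q η * charlierD ρ (ξ + Finsupp.single y k) η) * h η) := by
        intro η
        simp_rw [← hsplit]
        rw [charlierRem, sub_mul, sub_mul, Finset.sum_mul, Finset.sum_mul]
        simp_rw [← mul_assoc]
        ring
      have hint : ∀ k, Integrable (fun η => (Q η * charlierD ρ (ξ + Finsupp.single y k) η) * h η)
          (nu d ρ) := fun k => (hRL _).integrable_mul hh
      rw [hA]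
      simp_rw [e]
      rw [integral_add (f := fun η => (charlierRem ρ (m y) K (η y) * R η) * h η)
        ((hremL K).integrable_mul hh)
        (integrable_finsetSum _ fun k _ => (hint k).const_mul _),
        integral_finsetSum _ fun k _ => (hint k).const_mul _]
      simp_rw [integral_const_mul]
      rw [Finset.sum_eq_zero, add_zero]
      intro k _
      rw [ih (ξ + Finsupp.single y k), mul_zero]
      intro x hx
      have hxy : x ≠ y := fun e => hy (e ▸ hx)
      simp [hξ x (Finset.mem_insert_of_mem hx), hxy]
    have hbound : ∀ K, A ^ 2 ≤ (∫ n, charlierRem ρ (m y) K n ^ 2 ∂(poissonMeasure ρ)) *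
        ((∫ η, R η ^ 2 ∂(nu d ρ)) * ∫ η, h η ^ 2 ∂(nu d ρ)) := by
      intro K
      rw [hAK K, ← mul_assoc]
      refine (sq_integral_mul_le (hremL K) hh).trans_eq ?_
      congr 1
      simp_rw [mul_pow]
      have hm : Measurable fun η => charlierRem ρ (m y) K (η y) ^ 2 * R η ^ 2 :=
        (hmeas y fun n => charlierRem ρ (m y) K n ^ 2).mul (hRm.pow_const 2)
      rw [integral_eq_lintegral_of_nonneg_ae (.of_forall fun _ => by positivity)
        hm.aestronglyMeasurable,
        integral_eq_lintegral_of_nonneg_ae (.of_forall fun _ => by positivity)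
          Measurable.of_discrete.aestronglyMeasurable,
        integral_eq_lintegral_of_nonneg_ae (.of_forall fun _ => by positivity)
          (hRm.pow_const 2).aestronglyMeasurable, ← ENNReal.toReal_mul]
      congr 1
      rw [← lintegral_nu_mul y (fun n => ENNReal.ofReal (charlierRem ρ (m y) K n ^ 2))
        (R := fun η => ENNReal.ofReal (R η ^ 2)) (hRm.pow_const 2).ennreal_ofReal
        fun η n => by rw [hRy]]
      exact lintegral_congr fun η => ENNReal.ofReal_mul (by positivity)
    have hlim := (tendsto_integral_charlierRem_sq hρ (m y)).mul_const
      ((∫ η, R η ^ 2 ∂(nu d ρ)) * ∫ η, h η ^ 2 ∂(nu d ρ))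
    rw [zero_mul] at hlim
    have : A ^ 2 ≤ 0 := ge_of_tendsto' hlim hbound
    exact pow_eq_zero_iff two_ne_zero |>.1 (le_antisymm this (sq_nonneg _))

/-- The events that prescribe the occupation numbers of finitely many sites. -/
def cylinders (d : ℕ) : Set (Set (Config d)) :=
  {S | ∃ (F : Finset (Site d)) (m : Config d), S = {η | ∀ x ∈ F, η x = m x}}

theorem isPiSystem_cylinders : IsPiSystem (cylinders d) := by
  rintro _ ⟨F, m, rfl⟩ _ ⟨G, n, rfl⟩ ⟨η, h1, h2⟩
  classical
  refine ⟨F ∪ G, η, ?_⟩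
  ext ζ
  simp only [Set.mem_inter_iff, Set.mem_ofPred_eq, Finset.mem_union] at *
  constructor
  · rintro ⟨h3, h4⟩ x (hx | hx)
    · rw [h3 x hx, h1 x hx]
    · rw [h4 x hx, h2 x hx]
  · intro h
    exact ⟨fun x hx => by rw [h x (.inl hx), h1 x hx], fun x hx => by rw [h x (.inr hx), h2 x hx]⟩

theorem generateFrom_cylinders :
    MeasurableSpace.generateFrom (cylinders d) = (inferInstance : MeasurableSpace (Config d)) := by
  refine le_antisymm (MeasurableSpace.generateFrom_le ?_) ?_
  · rintro _ ⟨F, m, rfl⟩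
    have : {η : Config d | ∀ x ∈ F, η x = m x} = ⋂ x ∈ F, (fun η => η x) ⁻¹' {m x} := by
      ext η; simp
    rw [this]
    exact Finset.measurableSet_biInter _ fun x _ =>
      measurable_pi_apply x (measurableSet_singleton _)
  · refine iSup_le fun x => ?_
    rw [← measurable_iff_comap_le]
    refine @measurable_to_countable' _ _ _ _ (_) _ fun n => ?_
    refine MeasurableSpace.measurableSet_generateFrom ⟨{x}, fun _ => n, ?_⟩
    ext η
    simp

/-- Completeness of the Charlier polynomials. -/
theorem ae_eq_zero_of_orthogonal_charlierD (hρ : 0 < ρ) {h : Config d → ℝ}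
    (hh : MemLp h 2 (nu d ρ)) (h0 : ∀ ξ, ∫ η, charlierD ρ ξ η * h η ∂(nu d ρ) = 0) :
    h =ᵐ[nu d ρ] 0 := by
  have hint : Integrable h (nu d ρ) := hh.integrable (by norm_num)
  have hcyl : ∀ S ∈ cylinders d, ∫ η in S, h η ∂(nu d ρ) = 0 := by
    rintro _ ⟨F, m, rfl⟩
    have hS : MeasurableSet {η : Config d | ∀ x ∈ F, η x = m x} := by
      have h1 : {η : Config d | ∀ x ∈ F, η x = m x} ∈ cylinders d := ⟨F, m, rfl⟩
      have h2 := MeasurableSpace.measurableSet_generateFrom h1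
      rwa [generateFrom_cylinders] at h2
    have := integral_pi_indicator_mul_eq_zero hρ hh h0 F m 0 (by simp)
    rw [← this, ← integral_indicator hS]
    refine integral_congr_ae (.of_forall fun η => ?_)
    simp only [charlierD_zero, mul_one, Set.indicator_apply, Set.mem_ofPred_eq]
    split_ifs with h1
    · rw [Finset.prod_eq_one fun x hx => if_pos (h1 x hx), one_mul]
    · push Not at h1
      obtain ⟨x, hx, hne⟩ := h1
      rw [Finset.prod_eq_zero hx (if_neg hne), zero_mul]
  refine hint.ae_eq_zero_of_forall_setIntegral_eq_zero fun S hS _ => ?_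
  induction S, hS using MeasurableSpace.induction_on_inter generateFrom_cylinders.symm
    isPiSystem_cylinders with
  | empty => simp
  | basic S hS => exact hcyl S hS
  | compl S hS ih =>
    have h1 := integral_add_compl hS hint
    have h2 := hcyl Set.univ ⟨∅, 0, by simp⟩
    rw [setIntegral_univ] at h2
    have h3 := ih (measure_lt_top _ _)
    linarith
  | iUnion f hd hm ih =>
    rw [integral_iUnion hm hd hint.integrableOn]
    simp [ih]

variable (ρ) in
/-- The Charlier polynomial `D(ξ,·)` as an element of `L²(ν_ρ)`. -/
def charlierLp (ξ : FinConfig d) : Lp ℝ 2 (nu d ρ) := (memLp_charlierD ξ).toLp _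

theorem coeFn_charlierLp (ξ : FinConfig d) : charlierLp ρ ξ =ᵐ[nu d ρ] charlierD ρ ξ :=
  (memLp_charlierD ξ).coeFn_toLp

theorem inner_charlierLp (ξ : FinConfig d) (f : Lp ℝ 2 (nu d ρ)) :
    inner ℝ (charlierLp ρ ξ) f = ∫ η, charlierD ρ ξ η * f η ∂(nu d ρ) := by
  rw [L2.inner_def]
  refine integral_congr_ae ?_
  filter_upwards [coeFn_charlierLp ξ] with η h1
  simp [h1, mul_comm]

theorem inner_charlierLp_charlierLp (ξ ξ' : FinConfig d) :
    inner ℝ (charlierLp ρ ξ) (charlierLp ρ ξ') =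
      ∫ η, charlierD ρ ξ η * charlierD ρ ξ' η ∂(nu d ρ) := by
  rw [inner_charlierLp]
  refine integral_congr_ae ?_
  filter_upwards [coeFn_charlierLp ξ'] with η h1
  rw [h1]

theorem orthonormal_charlierLp (hρ : 0 < ρ) :
    Orthonormal ℝ fun ξ : FinConfig d => (√(normSq ρ ξ))⁻¹ • charlierLp ρ ξ := by
  classical
  rw [orthonormal_iff_ite]
  intro ξ ξ'
  rw [real_inner_smul_left, real_inner_smul_right, inner_charlierLp_charlierLp]
  split_ifs with h
  · subst h
    rw [← normSq_eq, ← mul_assoc, ← mul_inv, Real.mul_self_sqrt (normSq_pos hρ _).le,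
      inv_mul_cancel₀ (normSq_pos hρ _).ne']
  · rw [integral_charlierD_mul_of_ne hρ h]; simp

theorem hasSum_charlierLp (hρ : 0 < ρ) (f : Lp ℝ 2 (nu d ρ)) :
    HasSum (fun ξ : FinConfig d => (inner ℝ (charlierLp ρ ξ) f / normSq ρ ξ) • charlierLp ρ ξ) f := by
  have hbot : (Submodule.span ℝ (Set.range fun ξ : FinConfig d =>
      (√(normSq ρ ξ))⁻¹ • charlierLp ρ ξ))ᗮ = ⊥ := by
    rw [Submodule.eq_bot_iff]
    intro h hh
    have h0 : ∀ ξ, ∫ η, charlierD ρ ξ η * h η ∂(nu d ρ) = 0 := by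
      intro ξ
      have := Submodule.inner_right_of_mem_orthogonal (Submodule.subset_span (Set.mem_range_self ξ)) hh
      rw [real_inner_smul_left, inner_charlierLp] at this
      exact (mul_eq_zero.1 this).resolve_left
        (inv_ne_zero (Real.sqrt_pos.2 (normSq_pos hρ ξ)).ne')
    exact (Lp.eq_zero_iff_ae_eq_zero).2 (ae_eq_zero_of_orthogonal_charlierD hρ (Lp.memLp h) h0)
  have h := (HilbertBasis.mkOfOrthogonalEqBot (orthonormal_charlierLp hρ) hbot).hasSum_repr f
  refine h.congr_fun ?_
  intro ξ
  rw [HilbertBasis.repr_apply_apply, HilbertBasis.coe_mkOfOrthogonalEqBot, real_inner_smul_left,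
    smul_smul]
  congr 1
  rw [mul_right_comm, ← mul_inv, Real.mul_self_sqrt (normSq_pos hρ _).le]
  field_simp

/-- Projecting removes exactly the coefficients of degree below `k`: the generators of `hilbertH d ρ
(k - 1)` are orthogonal to all polynomials of higher degree. With `1 ≤ k`, degree at most `k - 1`
means degree less than `k`. -/
theorem inner_sub_projH (hρ : 0 < ρ) (f : Lp ℝ 2 (nu d ρ)) {k : ℕ} (hk : 1 ≤ k)
    (ξ : FinConfig d) :
    inner ℝ (charlierLp ρ ξ) (f - projH (k - 1) f) / normSq ρ ξ =
      if k ≤ ξ.degree then charlierCoeff f ξ else 0 := by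
  split_ifs with h
  · have hle : hilbertH d ρ (k - 1) ≤ (Submodule.span ℝ {charlierLp ρ ξ})ᗮ := by
      refine Submodule.topologicalClosure_minimal _ (Submodule.span_le.2 ?_)
        (Submodule.isClosed_orthogonal _)
      rintro g ⟨ξ', hξ', hg⟩
      rw [SetLike.mem_coe, Submodule.mem_orthogonal_singleton_iff_inner_right, inner_charlierLp]
      rw [← integral_charlierD_mul_of_ne hρ (ξ := ξ) (ξ' := ξ') (by rintro rfl; lia)]
      refine integral_congr_ae ?_
      filter_upwards [hg] with η h1
      rw [h1]
    have h2 := hle (Submodule.starProjection_apply_mem (hilbertH d ρ (k - 1)) f)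
    rw [Submodule.mem_orthogonal_singleton_iff_inner_right] at h2
    rw [inner_sub_right, projH, h2, sub_zero, inner_charlierLp, charlierCoeff]
    simp_rw [mul_comm]
  · have h1 : charlierLp ρ ξ ∈ hilbertH d ρ (k - 1) :=
      Submodule.le_topologicalClosure _
        (Submodule.subset_span (show _ ∈ {g | _} from ⟨ξ, by lia, coeFn_charlierLp ξ⟩))
    have h2 := Submodule.sub_starProjection_mem_orthogonal (K := hilbertH d ρ (k - 1)) f
    rw [projH, Submodule.inner_right_of_mem_orthogonal h1 h2, zero_div]

/-- The orthogonal expansion of `f - f_{k-1}`. -/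
theorem hasSum_sub_projH (hρ : 0 < ρ) (f : Lp ℝ 2 (nu d ρ)) {k : ℕ} (hk : 1 ≤ k) :
    HasSum (fun ξ : FinConfig d =>
      (if k ≤ ξ.degree then charlierCoeff f ξ else 0) • charlierLp ρ ξ) (f - projH (k - 1) f) := by
  have h := hasSum_charlierLp hρ (f - projH (k - 1) f)
  simp_rw [inner_sub_projH hρ f hk] at h
  exact h

end Completeness

/-! ### Heat kernel bound by Fourier inversion. -/

section HeatKernel

open Complex

variable {d : ℕ}

/-- The pairing of a frequency with a lattice point. -/
def dot (θ : Fin d → ℝ) (y : Site d) : ℝ := ∑ i, θ i * (y i : ℝ)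

/-- The character of `ℤ^d` with frequency `θ`. -/
def latticeChar (θ : Fin d → ℝ) (y : Site d) : ℂ := cexp (dot θ y * I)

theorem norm_latticeChar (θ : Fin d → ℝ) (y : Site d) : ‖latticeChar θ y‖ = 1 :=
  norm_exp_ofReal_mul_I _

theorem dot_add (θ : Fin d → ℝ) (y z : Site d) : dot θ (y + z) = dot θ y + dot θ z := by
  simp [dot, mul_add, Finset.sum_add_distrib]

theorem latticeChar_add (θ : Fin d → ℝ) (y z : Site d) :
    latticeChar θ (y + z) = latticeChar θ y * latticeChar θ z := by
  rw [latticeChar, dot_add, latticeChar, latticeChar, ← Complex.exp_add]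
  push_cast
  ring_nf

/-- The characteristic function of a law on the lattice. -/
def latticeCharFun (μ : PMF (Site d)) (θ : Fin d → ℝ) : ℂ :=
  ∑' y, ((μ y).toReal : ℂ) * latticeChar θ y

theorem summable_toReal_pmf {α : Type*} (μ : PMF α) : Summable fun a => (μ a).toReal :=
  ENNReal.summable_toReal (by rw [μ.tsum_coe]; simp)

theorem tsum_toReal_pmf {α : Type*} (μ : PMF α) : ∑' a, (μ a).toReal = 1 := by
  rw [← ENNReal.tsum_toReal_eq fun a => μ.apply_ne_top a, μ.tsum_coe]; rfl

theorem summable_pmf_mul {α : Type*} (μ : PMF α) {g : α → ℂ} (hg : ∀ a, ‖g a‖ ≤ 1) :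
    Summable fun a => ((μ a).toReal : ℂ) * g a := by
  refine Summable.of_norm_bounded (summable_toReal_pmf μ) fun a => ?_
  rw [norm_mul, norm_real, Real.norm_of_nonneg ENNReal.toReal_nonneg]
  exact mul_le_of_le_one_right ENNReal.toReal_nonneg (hg a)

theorem tsum_bind_mul {α β : Type*} (μ : PMF α) (f : α → PMF β) {g : β → ℂ}
    (hg : ∀ b, ‖g b‖ ≤ 1) :
    ∑' b, (((μ.bind f) b).toReal : ℂ) * g b =
      ∑' a, ((μ a).toReal : ℂ) * ∑' b, ((f a b).toReal : ℂ) * g b := by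
  have hs : Summable fun q : α × β => (μ q.1 * f q.1 q.2).toReal := by
    refine ENNReal.summable_toReal ?_
    rw [ENNReal.tsum_prod' (f := fun q : α × β => μ q.1 * f q.1 q.2)]
    simp [ENNReal.tsum_mul_left, PMF.tsum_coe]
  have hs2 : Summable fun q : α × β => ((μ q.1).toReal : ℂ) * (((f q.1 q.2).toReal : ℂ) * g q.2) := by
    refine Summable.of_norm_bounded hs fun q => ?_
    rw [ENNReal.toReal_mul, norm_mul, norm_mul, norm_real, norm_real,
      Real.norm_of_nonneg ENNReal.toReal_nonneg, Real.norm_of_nonneg ENNReal.toReal_nonneg]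
    exact mul_le_mul_of_nonneg_left
      (mul_le_of_le_one_right ENNReal.toReal_nonneg (hg _)) ENNReal.toReal_nonneg
  simp_rw [← tsum_mul_left]
  rw [← Summable.tsum_comm (f := fun a b => ((μ a).toReal : ℂ) * (((f a b).toReal : ℂ) * g b)) hs2]
  refine tsum_congr fun b => ?_
  rw [PMF.bind_apply, ENNReal.tsum_toReal_eq fun a =>
    ENNReal.mul_ne_top (μ.apply_ne_top a) ((f a).apply_ne_top b), ofReal_tsum, ← tsum_mul_right]
  refine tsum_congr fun a => ?_
  rw [ENNReal.toReal_mul]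
  push_cast
  ring

variable {p : Site d → PMF (Site d)}

theorem latticeCharFun_step (hp : ∀ i j, p i j = p 0 (j - i)) (z : Site d) (θ : Fin d → ℝ) :
    latticeCharFun (p z) θ = latticeChar θ z * latticeCharFun (p 0) θ := by
  unfold latticeCharFun
  rw [← tsum_mul_left, ← (Equiv.addRight z).tsum_eq]
  refine tsum_congr fun y => ?_
  simp only [Equiv.coe_addRight, latticeChar_add]
  rw [hp z (y + z), add_sub_cancel_right]
  ring

theorem latticeCharFun_bind (hp : ∀ i j, p i j = p 0 (j - i)) (μ : PMF (Site d))
    (θ : Fin d → ℝ) :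
    latticeCharFun (μ.bind p) θ = latticeCharFun μ θ * latticeCharFun (p 0) θ := by
  rw [latticeCharFun, tsum_bind_mul μ p fun b => (norm_latticeChar θ b).le]
  have : ∀ a, ∑' b, ((p a b).toReal : ℂ) * latticeChar θ b =
      latticeChar θ a * latticeCharFun (p 0) θ := fun a => latticeCharFun_step hp a θ
  simp_rw [this, ← mul_assoc]
  rw [tsum_mul_right]
  rfl

theorem latticeCharFun_pure (x : Site d) (θ : Fin d → ℝ) :
    latticeCharFun (PMF.pure x) θ = latticeChar θ x := by
  rw [latticeCharFun, tsum_eq_single x]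
  · simp
  · intro y hy
    simp [PMF.pure_apply, hy]

/-- A translation invariant step multiplies the characteristic function by that of `p 0`; averaging
the powers over a Poisson number of steps sums the exponential series. -/
theorem latticeCharFun_walkLaw (hp : ∀ i j, p i j = p 0 (j - i)) (t : ℝ≥0) (x : Site d)
    (θ : Fin d → ℝ) :
    latticeCharFun (walkLaw p t x) θ =
      latticeChar θ x * cexp (t * (latticeCharFun (p 0) θ - 1)) := by
  have hn : ∀ n : ℕ, latticeCharFun ((fun μ : PMF (Site d) => μ.bind p)^[n] (PMF.pure x)) θ =
      latticeChar θ x * latticeCharFun (p 0) θ ^ n := by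
    intro n
    induction n with
    | zero => simp [latticeCharFun_pure]
    | succ n ih => rw [Function.iterate_succ_apply', latticeCharFun_bind hp, ih, pow_succ, mul_assoc]
  rw [latticeCharFun, walkLaw, tsum_bind_mul _ _ fun b => (norm_latticeChar θ b).le]
  have h1 : ∀ n : ℕ, ((poissonMeasure t).toPMF n).toReal = Real.exp (-t) * t ^ n / n.factorial :=
    fun n => poissonMeasure_real_singleton t n
  have h2 : ∀ n : ℕ, ∑' b, ((((fun μ : PMF (Site d) => μ.bind p)^[n] (PMF.pure x)) b).toReal : ℂ) *
      latticeChar θ b = latticeChar θ x * latticeCharFun (p 0) θ ^ n := hn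
  simp_rw [h1, h2]
  have h3 := (NormedSpace.expSeries_div_hasSum_exp ((t : ℂ) * latticeCharFun (p 0) θ)).mul_left
    (latticeChar θ x * cexp (-t))
  rw [← Complex.exp_eq_exp_ℂ, mul_assoc, ← Complex.exp_add] at h3
  rw [show (t : ℂ) * (latticeCharFun (p 0) θ - 1) = -t + t * latticeCharFun (p 0) θ by ring,
    ← h3.tsum_eq]
  refine tsum_congr fun n => ?_
  push_cast
  rw [mul_pow]
  ring

theorem norm_latticeCharFun_walkLaw (hp : ∀ i j, p i j = p 0 (j - i)) (t : ℝ≥0) (x : Site d)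
    (θ : Fin d → ℝ) :
    ‖latticeCharFun (walkLaw p t x) θ‖ =
      Real.exp (-(t * (1 - (latticeCharFun (p 0) θ).re))) := by
  rw [latticeCharFun_walkLaw hp, norm_mul, norm_latticeChar, one_mul, Complex.norm_exp]
  congr 1
  simp
  ring

theorem re_latticeChar (θ : Fin d → ℝ) (y : Site d) :
    (latticeChar θ y).re = Real.cos (dot θ y) := exp_ofReal_mul_I_re _

theorem hasSum_one_sub_re (μ : PMF (Site d)) (θ : Fin d → ℝ) :
    HasSum (fun y => (μ y).toReal * (1 - Real.cos (dot θ y))) (1 - (latticeCharFun μ θ).re) := by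
  have h1 := (summable_pmf_mul μ (fun b => (norm_latticeChar θ b).le)).hasSum
  have h2 := (summable_toReal_pmf μ).hasSum
  rw [tsum_toReal_pmf] at h2
  refine (h2.sub (Complex.hasSum_re h1)).congr_fun fun y => ?_
  rw [re_ofReal_mul, re_latticeChar]
  ring

/-- Since `1 - cos x = 2 sin² (x / 2)`, this is `(u + v)² ≤ 2 u² + 2 v²` after the addition formula
for the sine. -/
theorem one_sub_cos_add_le (a b : ℝ) :
    1 - Real.cos (a + b) ≤ 2 * (1 - Real.cos a) + 2 * (1 - Real.cos b) := by
  have h : ∀ x : ℝ, 1 - Real.cos x = 2 * Real.sin (x / 2) ^ 2 := by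
    intro x
    have := Real.cos_sq' (x / 2)
    have h2 := Real.cos_sq (x / 2)
    rw [mul_div_cancel₀ x two_ne_zero] at h2
    linarith
  rw [h, h, h, add_div, Real.sin_add]
  set s := Real.sin (a / 2)
  set c := Real.cos (a / 2)
  set s' := Real.sin (b / 2)
  set c' := Real.cos (b / 2)
  have h1 : s ^ 2 + c ^ 2 = 1 := Real.sin_sq_add_cos_sq _
  have h2 : s' ^ 2 + c' ^ 2 = 1 := Real.sin_sq_add_cos_sq _
  have h3 : s ^ 2 * c' ^ 2 ≤ s ^ 2 := mul_le_of_le_one_right (sq_nonneg _) (by nlinarith [sq_nonneg s'])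
  have h4 : c ^ 2 * s' ^ 2 ≤ s' ^ 2 := mul_le_of_le_one_left (sq_nonneg _) (by nlinarith [sq_nonneg s])
  nlinarith [sq_nonneg (s * c' - c * s')]

/-- Follow a path of possible jumps from `0` to `y`. A single jump `z` is controlled because `p 0 z
* (1 - cos (dot θ z))` is one nonnegative term of `1 - Re` of the characteristic function; jumps are
concatenated by `one_sub_cos_add_le`. -/
theorem exists_one_sub_cos_le (hp : IsWalkTransition p) (y : Site d) :
    ∃ C : ℝ, 0 ≤ C ∧ ∀ θ : Fin d → ℝ,
      1 - Real.cos (dot θ y) ≤ C * (1 - (latticeCharFun (p 0) θ).re) := by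
  induction hp.irreducible 0 y with
  | refl => exact ⟨0, le_rfl, fun θ => by simp [dot]⟩
  | @tail y z _ hyz ih =>
    obtain ⟨C, hC, h⟩ := ih
    have hpos : 0 < (p 0 (z - y)).toReal := by
      rw [← hp.transl]
      exact ENNReal.toReal_pos hyz.ne' (PMF.apply_ne_top _ _)
    refine ⟨2 * C + 2 / (p 0 (z - y)).toReal, by positivity, fun θ => ?_⟩
    have h1 := one_sub_cos_add_le (dot θ y) (dot θ (z - y))
    rw [← dot_add, add_sub_cancel] at h1
    have h2 := (hasSum_one_sub_re (p 0) θ)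
    have h3 : (p 0 (z - y)).toReal * (1 - Real.cos (dot θ (z - y))) ≤
        1 - (latticeCharFun (p 0) θ).re :=
      le_hasSum h2 (z - y) fun w _ =>
        mul_nonneg ENNReal.toReal_nonneg (by linarith [Real.cos_le_one (dot θ w)])
    have h4 : 1 - Real.cos (dot θ (z - y)) ≤
        (1 - (latticeCharFun (p 0) θ).re) / (p 0 (z - y)).toReal := by
      rw [le_div_iff₀ hpos]; linarith
    calc _ ≤ _ := h1
      _ ≤ 2 * (C * (1 - (latticeCharFun (p 0) θ).re)) +
          2 * ((1 - (latticeCharFun (p 0) θ).re) / (p 0 (z - y)).toReal) := by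
        linarith [h θ]
      _ = _ := by ring

theorem one_sub_re_nonneg (μ : PMF (Site d)) (θ : Fin d → ℝ) :
    0 ≤ 1 - (latticeCharFun μ θ).re :=
  (hasSum_one_sub_re μ θ).nonneg fun y =>
    mul_nonneg ENNReal.toReal_nonneg (by linarith [Real.cos_le_one (dot θ y)])

/-- Apply the previous bound to the unit vectors and use `1 - cos s ≥ 2 s² / π²` on `[-π, π]`. This
is where irreducibility enters the heat kernel bound. -/
theorem exists_sq_le_one_sub_re (hp : IsWalkTransition p) :
    ∃ c : ℝ, 0 < c ∧ ∀ θ : Fin d → ℝ, (∀ i, |θ i| ≤ Real.pi) →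
      c * ∑ i, θ i ^ 2 ≤ 1 - (latticeCharFun (p 0) θ).re := by
  choose C hC h using fun i : Fin d => exists_one_sub_cos_le hp (Pi.single i 1)
  set S := ∑ i, C i with hS
  have hS0 : 0 ≤ S := Finset.sum_nonneg fun i _ => hC i
  -- The summand `1` keeps the inverse positive when `S = 0`.
  refine ⟨(Real.pi ^ 2 / 2 * S + 1)⁻¹, by positivity, fun θ hθ => ?_⟩
  set u := 1 - (latticeCharFun (p 0) θ).re with hu
  have hu0 : 0 ≤ u := one_sub_re_nonneg _ _
  have h1 : ∀ i, θ i ^ 2 ≤ Real.pi ^ 2 / 2 * (C i * u) := by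
    intro i
    have h2 := h i θ
    have h3 : dot θ (Pi.single i 1) = θ i := by
      rw [dot, Finset.sum_eq_single i]
      · simp
      · intro j _ hj; simp [hj]
      · simp
    rw [h3] at h2
    have h4 := Real.cos_le_one_sub_mul_cos_sq (hθ i)
    have h5 : 2 / Real.pi ^ 2 * θ i ^ 2 ≤ C i * u := by linarith
    calc θ i ^ 2 = Real.pi ^ 2 / 2 * (2 / Real.pi ^ 2 * θ i ^ 2) := by
          have := Real.pi_ne_zero
          field_simp
      _ ≤ _ := by gcongr
  rw [inv_mul_le_iff₀ (by positivity)]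
  calc ∑ i, θ i ^ 2 ≤ ∑ i, Real.pi ^ 2 / 2 * (C i * u) := Finset.sum_le_sum fun i _ => h1 i
    _ = Real.pi ^ 2 / 2 * S * u := by rw [← Finset.mul_sum, ← Finset.sum_mul]; ring
    _ ≤ _ := by nlinarith

/-- Lebesgue measure on the cube of frequencies. -/
def freqMeasure (d : ℕ) : Measure (Fin d → ℝ) :=
  Measure.pi fun _ => (volume : Measure ℝ).restrict (Set.Ioc (-Real.pi) Real.pi)

instance : IsFiniteMeasure (freqMeasure d) := by unfold freqMeasure; infer_instance

theorem ae_freqMeasure : ∀ᵐ θ ∂(freqMeasure d), ∀ i, |θ i| ≤ Real.pi := by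
  rw [freqMeasure, ← Measure.restrict_pi_pi]
  refine (ae_restrict_mem (.univ_pi fun _ => measurableSet_Ioc)).mono fun θ hθ i => ?_
  have := hθ i (Set.mem_univ i)
  exact abs_le.2 ⟨this.1.le, this.2⟩

theorem integral_exp_int (n : ℤ) :
    ∫ s in Set.Ioc (-Real.pi) Real.pi, cexp ((s * (n : ℝ) : ℝ) * I) =
      if n = 0 then ((2 * Real.pi : ℝ) : ℂ) else 0 := by
  rw [← intervalIntegral.integral_of_le (by linarith [Real.pi_pos])]
  split_ifs with h
  · subst h
    simp
    ring
  · have hc : (n : ℂ) * I ≠ 0 := mul_ne_zero (by exact_mod_cast h) I_ne_zero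
    have e : ∀ s : ℝ, cexp ((s * (n : ℝ) : ℝ) * I) = cexp ((n : ℂ) * I * s) := by
      intro s; push_cast; ring_nf
    simp_rw [e]
    rw [integral_exp_mul_complex hc, div_eq_zero_iff]
    left
    rw [sub_eq_zero, Complex.exp_eq_exp_iff_exists_int]
    exact ⟨n, by push_cast; ring⟩

theorem continuous_latticeChar (y : Site d) : Continuous fun θ => latticeChar θ y := by
  unfold latticeChar dot
  fun_prop

theorem integral_latticeChar (y : Site d) :
    ∫ θ, latticeChar θ y ∂(freqMeasure d) = if y = 0 then (((2 * Real.pi) ^ d : ℝ) : ℂ) else 0 := by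
  have e : ∀ θ : Fin d → ℝ, latticeChar θ y = ∏ i, cexp ((θ i * (y i : ℝ) : ℝ) * I) := by
    intro θ
    rw [latticeChar, dot, ← Complex.exp_sum, ← Finset.sum_mul]
    push_cast
    rfl
  simp_rw [e]
  rw [freqMeasure, integral_fintype_prod_eq_prod (𝕜 := ℂ)
    (fun (i : Fin d) (s : ℝ) => cexp ((s * (y i : ℝ) : ℝ) * I))]
  simp_rw [integral_exp_int]
  split_ifs with h
  · subst h
    simp
  · obtain ⟨i, hi⟩ := Function.ne_iff.1 h
    exact Finset.prod_eq_zero (Finset.mem_univ i) (if_neg hi)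

/-- Fourier inversion bounds the atoms of a law on the lattice. -/
theorem pmf_apply_le_integral (μ : PMF (Site d)) (y : Site d) :
    (2 * Real.pi) ^ d * (μ y).toReal ≤ ∫ θ, ‖latticeCharFun μ θ‖ ∂(freqMeasure d) := by
  have hterm : ∀ z θ, ((μ z).toReal : ℂ) * latticeChar θ z * latticeChar θ (-y) =
      ((μ z).toReal : ℂ) * latticeChar θ (z - y) := by
    intro z θ
    rw [sub_eq_add_neg, latticeChar_add, mul_assoc]
  have h1 : HasSum (fun z => ∫ θ, ((μ z).toReal : ℂ) * latticeChar θ (z - y) ∂(freqMeasure d))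
      (∫ θ, ∑' z, ((μ z).toReal : ℂ) * latticeChar θ (z - y) ∂(freqMeasure d)) := by
    refine hasSum_integral_of_summable_integral_norm (fun z => ?_) ?_
    · refine Integrable.const_mul ?_ _
      exact Integrable.of_bound (continuous_latticeChar _).aestronglyMeasurable 1
        (.of_forall fun θ => (norm_latticeChar θ _).le)
    · simp only [norm_mul, norm_latticeChar, mul_one, integral_const, norm_real,
        Real.norm_of_nonneg ENNReal.toReal_nonneg]
      exact (summable_toReal_pmf μ).const_smul _
  have h2 : ∀ z, ∫ θ, ((μ z).toReal : ℂ) * latticeChar θ (z - y) ∂(freqMeasure d) =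
      if z = y then ((μ y).toReal : ℂ) * (((2 * Real.pi) ^ d : ℝ) : ℂ) else 0 := by
    intro z
    rw [integral_const_mul, integral_latticeChar]
    by_cases h : z = y
    · simp [h]
    · simp [h, sub_eq_zero]
  simp_rw [h2] at h1
  have h3 := h1.unique (hasSum_ite_eq y _)
  have h4 : ∀ θ, ∑' z, ((μ z).toReal : ℂ) * latticeChar θ (z - y) =
      latticeCharFun μ θ * latticeChar θ (-y) := by
    intro θ
    rw [latticeCharFun, ← tsum_mul_right]
    exact tsum_congr fun z => (hterm z θ).symm
  simp_rw [h4] at h3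
  have h5 := norm_integral_le_integral_norm (μ := freqMeasure d)
    (fun θ => latticeCharFun μ θ * latticeChar θ (-y))
  rw [h3] at h5
  simp only [norm_mul, norm_latticeChar, mul_one, norm_real,
    Real.norm_of_nonneg ENNReal.toReal_nonneg] at h5
  rwa [Real.norm_of_nonneg (by positivity), mul_comm] at h5

/-- The heat kernel bound. -/
theorem exists_walkLaw_le (hp : IsWalkTransition p) :
    ∃ K : ℝ, 0 ≤ K ∧ ∀ t : ℝ≥0, 0 < t → ∀ x y,
      (walkLaw p t x y).toReal ≤ (K / √t) ^ d := by
  obtain ⟨c, hc, h⟩ := exists_sq_le_one_sub_re hp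
  refine ⟨√(Real.pi / c) / (2 * Real.pi), by positivity, fun t ht x y => ?_⟩
  have ht' : (0 : ℝ) < t := ht
  have h1 := pmf_apply_le_integral (walkLaw p t x) y
  have hg : ∀ θ : Fin d → ℝ, Real.exp (-(t * (c * ∑ i, θ i ^ 2))) =
      ∏ i, Real.exp (-(t * c) * θ i ^ 2) := by
    intro θ
    rw [← Real.exp_sum, ← Finset.mul_sum]
    congr 1; ring
  -- On the cube the characteristic function is dominated by a Gaussian, whose integral is then
  -- enlarged to the whole line in each coordinate.
  have h2 : ∫ θ, ‖latticeCharFun (walkLaw p t x) θ‖ ∂(freqMeasure d) ≤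
      ∫ θ : Fin d → ℝ, ∏ i, Real.exp (-(t * c) * θ i ^ 2) ∂(freqMeasure d) := by
    refine integral_mono_of_nonneg (.of_forall fun θ => norm_nonneg _) ?_ ?_
    · refine Integrable.of_bound (C := 1)
        (Continuous.aestronglyMeasurable (by fun_prop)) (.of_forall fun θ => ?_)
      rw [← hg, Real.norm_of_nonneg (Real.exp_pos _).le, Real.exp_le_one_iff, neg_nonpos]
      positivity
    · filter_upwards [ae_freqMeasure] with θ hθ
      rw [norm_latticeCharFun_walkLaw hp.transl, ← hg]
      have := h θ hθ
      gcongr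
  have h3 : ∫ θ : Fin d → ℝ, ∏ i, Real.exp (-(t * c) * θ i ^ 2) ∂(freqMeasure d) ≤
      √(Real.pi / (t * c)) ^ d := by
    rw [freqMeasure, integral_fintype_prod_eq_prod (𝕜 := ℝ)
      (fun (_ : Fin d) (s : ℝ) => Real.exp (-(t * c) * s ^ 2)), Finset.prod_const,
      Finset.card_univ, Fintype.card_fin, ← integral_gaussian]
    refine pow_le_pow_left₀ (integral_nonneg fun _ => (Real.exp_pos _).le) ?_ d
    exact setIntegral_le_integral (integrable_exp_neg_mul_sq (by positivity))
      (.of_forall fun _ => (Real.exp_pos _).le)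
  have h4 : (walkLaw p t x y).toReal ≤ √(Real.pi / (t * c)) ^ d / (2 * Real.pi) ^ d := by
    rw [le_div_iff₀ (by positivity), mul_comm]
    exact h1.trans (h2.trans h3)
  refine h4.trans_eq ?_
  have e : √(Real.pi / (t * c)) = √(Real.pi / c) / √t := by
    rw [mul_comm, ← div_div, Real.sqrt_div (by positivity)]
  rw [← div_pow, e, div_right_comm]

end HeatKernel

/-! ### Sums of a Schwartz function over the scaled lattice. -/

section LatticeSum

variable {d : ℕ}

/-- Every finite set of sites lies in a box, over which the sum of products factorizes. -/
theorem tsum_fin_pi_prod_le (g : ℤ → ℝ≥0∞) :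
    ∑' x : Site d, ∏ i, g (x i) ≤ (∑' m, g m) ^ d := by
  rw [ENNReal.tsum_eq_iSup_sum]
  refine iSup_le fun s => ?_
  calc ∑ x ∈ s, ∏ i, g (x i)
      ≤ ∑ x ∈ Fintype.piFinset fun i : Fin d => s.image fun x => x i, ∏ i, g (x i) := by
        refine Finset.sum_le_sum_of_subset fun x hx => ?_
        exact Fintype.mem_piFinset.2 fun i => Finset.mem_image_of_mem _ hx
    _ = ∏ i : Fin d, ∑ m ∈ s.image fun x => x i, g m := (Finset.prod_univ_sum _ _).symm
    _ ≤ ∏ _i : Fin d, ∑' m, g m := Finset.prod_le_prod' fun i _ => ENNReal.sum_le_tsum _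
    _ = _ := by simp

/-- Write `m = q N + r` with `0 ≤ r < N`. Then `1 + q² ≤ 3 (1 + (m/N)²)`, so each of the `N`
residues contributes at most a fixed convergent sum. -/
theorem exists_tsum_scaled_le : ∃ B : ℝ≥0, ∀ N : ℕ, 1 ≤ N →
    ∑' m : ℤ, ENNReal.ofReal (1 + ((m : ℝ) / N) ^ 2)⁻¹ ≤ B * N := by
  have hs : Summable fun q : ℤ => (1 + (q : ℝ) ^ 2)⁻¹ := by
    have h := Real.summable_one_div_int_pow (p := 2) |>.2 (by norm_num)
    refine (summable_of_ne_finset_zero (f := fun q : ℤ => if q = 0 then (1 : ℝ) else 0)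
      (s := {0}) (by simp)).add h |>.of_nonneg_of_le (fun q => by positivity) fun q => ?_
    by_cases hq : q = 0
    · simp [hq]
    · have : (0 : ℝ) < (q : ℝ) ^ 2 := by positivity
      rw [if_neg hq, zero_add, one_div]
      gcongr
      linarith
  have hfin : ∑' q : ℤ, ENNReal.ofReal (1 + (q : ℝ) ^ 2)⁻¹ ≠ ∞ := by
    rw [← ENNReal.ofReal_tsum_of_nonneg (fun q => by positivity) hs]
    simp
  refine ⟨3 * (∑' q : ℤ, ENNReal.ofReal (1 + (q : ℝ) ^ 2)⁻¹).toNNReal, fun N hN => ?_⟩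
  have : NeZero N := ⟨by lia⟩
  have hN' : (0 : ℝ) < N := by exact_mod_cast hN
  rw [← (Int.divModEquiv N).symm.tsum_eq, ENNReal.tsum_prod']
  have hle : ∀ (q : ℤ) (r : Fin N), ENNReal.ofReal
      (1 + (((Int.divModEquiv N).symm (q, r) : ℤ) / N : ℝ) ^ 2)⁻¹ ≤
      3 * ENNReal.ofReal (1 + (q : ℝ) ^ 2)⁻¹ := by
    intro q r
    rw [show (3 : ℝ≥0∞) = ENNReal.ofReal 3 by simp, ← ENNReal.ofReal_mul (by norm_num)]
    refine ENNReal.ofReal_le_ofReal ?_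
    have e : (((Int.divModEquiv N).symm (q, r) : ℤ) : ℝ) / N = q + (r : ℕ) / N := by
      simp only [Int.divModEquiv, Equiv.coe_fn_symm_mk]
      push_cast
      field_simp
    rw [e, ← div_eq_mul_inv, inv_eq_one_div, div_le_div_iff₀ (by positivity) (by positivity)]
    have hr0 : 0 ≤ ((r : ℕ) : ℝ) / N := by positivity
    have hr1 : ((r : ℕ) : ℝ) / N ≤ 1 := by
      rw [div_le_one hN']; exact_mod_cast r.2.le
    nlinarith [sq_nonneg ((q : ℝ) + 2 * ((r : ℕ) / N))]
  calc _ ≤ ∑' (q : ℤ) (_ : Fin N), 3 * ENNReal.ofReal (1 + (q : ℝ) ^ 2)⁻¹ :=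
        ENNReal.tsum_le_tsum fun q => ENNReal.tsum_le_tsum fun r => hle q r
    _ = _ := by
        simp only [tsum_fintype, Finset.sum_const, Finset.card_univ, Fintype.card_fin, nsmul_eq_mul]
        rw [ENNReal.tsum_mul_left, ENNReal.tsum_mul_left]
        push_cast
        rw [ENNReal.coe_toNNReal hfin]
        ring

/-- Riemann sums of a Schwartz function on the scaled lattice. -/
theorem exists_tsum_schwartz_le (φ : 𝓢(EuclideanSpace ℝ (Fin d), ℝ)) :
    ∃ A : ℝ, 0 ≤ A ∧ ∀ N : ℕ, 1 ≤ N → Summable (fun x : Site d => |φ (scaled N x)|) ∧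
      ∑' x : Site d, |φ (scaled N x)| ≤ A * (N : ℝ) ^ d := by
  obtain ⟨B, hB⟩ := exists_tsum_scaled_le
  -- Decay of order `2 * d` dominates the product of `1 + u i ^ 2` over the `d` coordinates.
  obtain ⟨C, hC⟩ : ∃ C : ℝ, ∀ u, (1 + ‖u‖) ^ (2 * d) * |φ u| ≤ C := ⟨_, fun u => by
    have := SchwartzMap.one_add_le_sup_seminorm_apply (𝕜 := ℝ) (m := (2 * d, 0)) (k := 2 * d)
      (n := 0) le_rfl le_rfl φ u
    rwa [norm_iteratedFDeriv_zero, Real.norm_eq_abs] at this⟩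
  have hC0 : 0 ≤ C := le_trans (by positivity) (hC 0)
  refine ⟨C * B ^ d, by positivity, fun N hN => ?_⟩
  have hpt : ∀ x : Site d, ENNReal.ofReal |φ (scaled N x)| ≤
      ENNReal.ofReal C * ∏ i, ENNReal.ofReal (1 + ((x i : ℝ) / N) ^ 2)⁻¹ := by
    intro x
    rw [← ENNReal.ofReal_prod_of_nonneg (fun i _ => by positivity), ← ENNReal.ofReal_mul hC0]
    refine ENNReal.ofReal_le_ofReal ?_
    rw [Finset.prod_inv_distrib, ← div_eq_mul_inv, le_div_iff₀ (by positivity)]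
    refine le_trans ?_ (hC (scaled N x))
    rw [mul_comm]
    refine mul_le_mul_of_nonneg_right ?_ (abs_nonneg _)
    rw [pow_mul]
    calc ∏ i, (1 + ((x i : ℝ) / N) ^ 2) ≤ ∏ _i : Fin d, (1 + ‖scaled N x‖) ^ 2 := by
          refine Finset.prod_le_prod (fun i _ => by positivity) fun i _ => ?_
          have h1 : ‖(scaled N x) i‖ ≤ ‖scaled N x‖ := PiLp.norm_apply_le _ i
          have h2 : (scaled N x) i = (x i : ℝ) / N := rfl
          rw [h2, Real.norm_eq_abs] at h1
          have h3 : ((x i : ℝ) / N) ^ 2 ≤ ‖scaled N x‖ ^ 2 := by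
            rw [← sq_abs]; gcongr
          nlinarith [norm_nonneg (scaled N x)]
      _ = _ := by simp
  have htot : ∑' x : Site d, ENNReal.ofReal |φ (scaled N x)| ≤
      ENNReal.ofReal (C * B ^ d * (N : ℝ) ^ d) := by
    calc _ ≤ ∑' x : Site d, ENNReal.ofReal C *
          ∏ i, ENNReal.ofReal (1 + ((x i : ℝ) / N) ^ 2)⁻¹ := ENNReal.tsum_le_tsum hpt
      _ ≤ ENNReal.ofReal C * (B * N) ^ d := by
          rw [ENNReal.tsum_mul_left]
          gcongr
          exact (tsum_fin_pi_prod_le fun m : ℤ => ENNReal.ofReal (1 + ((m : ℝ) / N) ^ 2)⁻¹).trans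
            (pow_le_pow_left' (hB N hN) d)
      _ = _ := by
          rw [mul_assoc, ENNReal.ofReal_mul hC0, ← mul_pow, ENNReal.ofReal_pow (by positivity),
            ENNReal.ofReal_mul (by positivity), ENNReal.ofReal_coe_nnreal, ENNReal.ofReal_natCast]
  have hs : Summable fun x : Site d => |φ (scaled N x)| := by
    have := ENNReal.summable_toReal (ne_top_of_le_ne_top ENNReal.ofReal_ne_top htot)
    simpa using this
  refine ⟨hs, ?_⟩
  rw [← ENNReal.ofReal_tsum_of_nonneg (fun _ => abs_nonneg _) hs] at htot
  exact (ENNReal.ofReal_le_ofReal_iff (by positivity)).1 htot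

end LatticeSum

/-! ### Products of random series with summable weights. -/

section Series

variable {Ω ι : Type*} [MeasurableSpace Ω] {P : Measure Ω}
  {c : ι → ℝ} {Y Z : ι → Ω → ℝ} {M : ℝ}

theorem ae_summable_of_integral_norm [Countable ι] {F : ι → Ω → ℝ} (hF : ∀ i, Integrable (F i) P)
    (hs : Summable fun i => ∫ ω, ‖F i ω‖ ∂P) : ∀ᵐ ω ∂P, Summable fun i => ‖F i ω‖ := by
  have h1 : ∫⁻ ω, ∑' i, ‖F i ω‖ₑ ∂P ≠ ∞ := by
    rw [lintegral_tsum fun i => (hF i).1.enorm]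
    have : ∀ i, ∫⁻ ω, ‖F i ω‖ₑ ∂P = ENNReal.ofReal (∫ ω, ‖F i ω‖ ∂P) := fun i =>
      (ofReal_integral_norm_eq_lintegral_enorm (hF i)).symm
    simp_rw [this]
    rw [← ENNReal.ofReal_tsum_of_nonneg (fun i => integral_nonneg fun _ => norm_nonneg _) hs]
    exact ENNReal.ofReal_ne_top
  have h2 : AEMeasurable (fun ω => ∑' i, ‖F i ω‖ₑ) P :=
    AEMeasurable.tsum fun i => (hF i).1.enorm
  filter_upwards [ae_lt_top' h2 h1] with ω hω
  simpa using ENNReal.summable_toReal hω.ne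

theorem integral_norm_mul_le (hY : ∀ i, MemLp (Y i) 2 P) (hZ : ∀ i, MemLp (Z i) 2 P)
    (hYM : ∀ i, ∫ ω, Y i ω ^ 2 ∂P ≤ M) (hZM : ∀ i, ∫ ω, Z i ω ^ 2 ∂P ≤ M) (i j : ι) :
    ∫ ω, ‖Y i ω * Z j ω‖ ∂P ≤ M := by
  calc ∫ ω, ‖Y i ω * Z j ω‖ ∂P ≤ ∫ ω, (Y i ω ^ 2 / 2 + Z j ω ^ 2 / 2) ∂P := by
        refine integral_mono ((hY i).integrable_mul (hZ j)).norm
          (((hY i).integrable_sq.div_const _).add ((hZ j).integrable_sq.div_const _)) fun ω => ?_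
        simp only [Real.norm_eq_abs, abs_mul]
        rw [← sq_abs (Y i ω), ← sq_abs (Z j ω)]
        nlinarith [sq_nonneg (|Y i ω| - |Z j ω|)]
    _ ≤ M := by
        rw [integral_add ((hY i).integrable_sq.div_const _) ((hZ j).integrable_sq.div_const _),
          integral_div, integral_div]
        linarith [hYM i, hZM j]

variable [Countable ι] [IsFiniteMeasure P]

theorem ae_summable_mul (hc : Summable fun i => |c i|) (hY : ∀ i, MemLp (Y i) 2 P)
    (hM : ∀ i, ∫ ω, Y i ω ^ 2 ∂P ≤ M) : ∀ᵐ ω ∂P, Summable fun i => ‖c i * Y i ω‖ := by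
  refine ae_summable_of_integral_norm
    (fun i => ((hY i).integrable (by norm_num)).const_mul _) ?_
  refine (hc.mul_right (P.real Set.univ + M)).of_nonneg_of_le
    (fun i => integral_nonneg fun _ => norm_nonneg _) fun i => ?_
  simp_rw [norm_mul]
  rw [integral_const_mul]
  refine mul_le_mul_of_nonneg_left ?_ (abs_nonneg _)
  calc ∫ ω, ‖Y i ω‖ ∂P ≤ ∫ ω, (1 + Y i ω ^ 2) ∂P := by
        refine integral_mono ((hY i).integrable (by norm_num)).norm
          ((integrable_const 1).add (hY i).integrable_sq) fun ω => ?_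
        simp only [Real.norm_eq_abs]
        rw [← sq_abs]
        nlinarith [sq_nonneg (|Y i ω| - 1), abs_nonneg (Y i ω)]
    _ ≤ _ := by
        rw [integral_add (integrable_const 1) (hY i).integrable_sq]
        simpa using hM i

/-- The product of two random series. -/
theorem integrable_series_mul_and_bound {b : ℝ} (hc : Summable fun i => |c i|)
    (hY : ∀ i, MemLp (Y i) 2 P) (hZ : ∀ i, MemLp (Z i) 2 P)
    (hYM : ∀ i, ∫ ω, Y i ω ^ 2 ∂P ≤ M) (hZM : ∀ i, ∫ ω, Z i ω ^ 2 ∂P ≤ M)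
    (hb : ∀ i j, |∫ ω, Y i ω * Z j ω ∂P| ≤ b) :
    Integrable (fun ω => (∑' i, c i * Y i ω) * ∑' j, c j * Z j ω) P ∧
      |∫ ω, (∑' i, c i * Y i ω) * ∑' j, c j * Z j ω ∂P| ≤ (∑' i, |c i|) ^ 2 * b := by
  set F : ι × ι → Ω → ℝ := fun q ω => (c q.1 * Y q.1 ω) * (c q.2 * Z q.2 ω) with hF
  have hFe : ∀ q ω, F q ω = (c q.1 * c q.2) * (Y q.1 ω * Z q.2 ω) := fun q ω => by
    simp only [hF]; ring
  have hFi : ∀ q, Integrable (F q) P := fun q => by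
    have : F q = fun ω => (c q.1 * c q.2) * (Y q.1 ω * Z q.2 ω) := funext (hFe q)
    rw [this]
    exact ((hY q.1).integrable_mul (hZ q.2)).const_mul _
  have hcc : Summable fun q : ι × ι => |c q.1| * |c q.2| :=
    hc.mul_of_nonneg hc (fun _ => abs_nonneg _) fun _ => abs_nonneg _
  have hFs : Summable fun q => ∫ ω, ‖F q ω‖ ∂P := by
    refine (hcc.mul_right M).of_nonneg_of_le
      (fun i => integral_nonneg fun _ => norm_nonneg _) fun q => ?_
    simp_rw [hFe, norm_mul (c q.1 * c q.2)]
    rw [integral_const_mul, norm_mul]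
    exact mul_le_mul_of_nonneg_left (integral_norm_mul_le hY hZ hYM hZM _ _) (by positivity)
  have hsum := hasSum_integral_of_summable_integral_norm hFi hFs
  have hprod : (fun ω => ∑' q, F q ω) =ᵐ[P]
      fun ω => (∑' i, c i * Y i ω) * ∑' j, c j * Z j ω := by
    filter_upwards [ae_summable_mul hc hY hYM, ae_summable_mul hc hZ hZM] with ω h1 h2
    exact (tsum_mul_tsum_of_summable_norm h1 h2).symm
  have hFae := ae_summable_of_integral_norm hFi hFs
  constructor
  · refine Integrable.congr ⟨?_, ?_⟩ hprod
    · refine aestronglyMeasurable_of_tendsto_ae Filter.atTop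
        (f := fun (s : Finset (ι × ι)) ω => ∑ q ∈ s, F q ω) (fun s => ?_) ?_
      · exact Finset.aestronglyMeasurable_fun_sum s fun q _ => (hFi q).1
      · filter_upwards [hFae] with ω hω using hω.of_norm.hasSum
    · have h1 : ∫⁻ ω, ∑' q, ‖F q ω‖ₑ ∂P < ∞ := by
        rw [lintegral_tsum fun i => (hFi i).1.enorm]
        have : ∀ q, ∫⁻ ω, ‖F q ω‖ₑ ∂P = ENNReal.ofReal (∫ ω, ‖F q ω‖ ∂P) := fun q =>
          (ofReal_integral_norm_eq_lintegral_enorm (hFi q)).symm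
        simp_rw [this]
        rw [← ENNReal.ofReal_tsum_of_nonneg (fun i => integral_nonneg fun _ => norm_nonneg _) hFs]
        exact ENNReal.ofReal_lt_top
      refine lt_of_le_of_lt (lintegral_mono fun ω => ?_) h1
      exact enorm_tsum_le_tsum_enorm
  · rw [← integral_congr_ae hprod, ← hsum.tsum_eq]
    have hle : ∀ q, ‖∫ ω, F q ω ∂P‖ ≤ |c q.1| * |c q.2| * b := by
      intro q
      simp_rw [hFe]
      rw [integral_const_mul, norm_mul, norm_mul]
      exact mul_le_mul_of_nonneg_left (hb _ _) (by positivity)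
    rw [← Real.norm_eq_abs]
    refine (tsum_of_norm_bounded (hcc.mul_right b).hasSum hle).trans_eq ?_
    rw [tsum_mul_right, pow_two, hc.tsum_mul_tsum hc hcc]

end Series

/-! ### Spatial shifts. -/

section Shift

variable {d : ℕ} {ρ : ℝ≥0}

theorem measurable_shift (x : Site d) : Measurable (shift x) :=
  measurable_pi_lambda _ fun y => measurable_pi_apply (y + x)

theorem measurePreserving_shift (x : Site d) : MeasurePreserving (shift x) (nu d ρ) (nu d ρ) := by
  refine ⟨measurable_shift x, Measure.eq_infinitePi _ fun s t ht => ?_⟩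
  rw [Measure.map_apply (measurable_shift x) (.pi s.countable_toSet fun i _ => ht i)]
  have : shift x ⁻¹' (Set.pi s t) =
      Set.pi (s.map (Equiv.addRight x).toEmbedding : Finset (Site d)) fun y => t (y - x) := by
    ext η
    simp only [Set.mem_preimage, Set.mem_pi, shift, Finset.mem_coe, Finset.mem_map_equiv]
    constructor
    · intro h i hi
      simpa [sub_eq_add_neg] using h (i + -x) (by simpa using hi)
    · intro h i hi
      simpa using h (i + x) (by simpa using hi)
  rw [this, nu, Measure.infinitePi_pi _ fun i _ => ht _]
  simp

theorem charlierD_shift (ξ : FinConfig d) (x : Site d) (η : Config d) :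
    charlierD ρ ξ (shift x η) = charlierD ρ (ξ.mapDomain (· + x)) η := by
  rw [charlierD, charlierD, Finsupp.prod_mapDomain_index_inj (add_left_injective x)]
  rfl

theorem normSq_mapDomain (ξ : FinConfig d) (x : Site d) :
    normSq ρ (ξ.mapDomain (· + x)) = normSq ρ ξ := by
  have h := measurePreserving_shift (ρ := ρ) x
  simp_rw [normSq, ← charlierD_shift]
  conv_rhs => rw [← h.map_eq]
  rw [integral_map h.measurable.aemeasurable
    ((measurable_charlierD ξ).pow_const 2).aestronglyMeasurable]

end Shift

/-! ### Covariances of shifted copies under a Mecke coupling. -/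

section Covariance

variable {d : ℕ} {ρ : ℝ≥0} {w : Site d → PMF (Site d)} {J : Measure (Config d × Config d)}

/-- Only square partial sums are estimated; continuity of the inner product passes the bound to the
limit. -/
theorem abs_le_of_hasSum_inner {ι H : Type*} [NormedAddCommGroup H] [InnerProductSpace ℝ H]
    {u v : ι → H} {U V : H} (hu : HasSum u U) (hv : HasSum v V) {b : ℝ}
    (h : ∀ s : Finset ι, ∑ i ∈ s, ∑ j ∈ s, |inner ℝ (u i) (v j)| ≤ b) : |inner ℝ U V| ≤ b := by
  have ht : Filter.Tendsto (fun s : Finset ι => |inner ℝ (∑ i ∈ s, u i) (∑ j ∈ s, v j)|)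
      Filter.atTop (𝓝 |inner ℝ U V|) := (Filter.Tendsto.inner hu hv).abs
  refine le_of_tendsto' ht fun s => ?_
  rw [sum_inner]
  refine (Finset.abs_sum_le_sum_abs _ _).trans (le_trans (Finset.sum_le_sum fun i _ => ?_) (h s))
  rw [inner_sum]
  exact Finset.abs_sum_le_sum_abs _ _

theorem inner_compMeasurePreserving {α : Type*} [MeasurableSpace α] {μ : Measure α}
    {β : Type*} [MeasurableSpace β] {ν : Measure β} {A B : α → β}
    (hA : MeasurePreserving A μ ν) (hB : MeasurePreserving B μ ν) (u v : Lp ℝ 2 ν) :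
    inner ℝ (Lp.compMeasurePreservingₗᵢ ℝ A hA u) (Lp.compMeasurePreservingₗᵢ ℝ B hB v) =
      ∫ a, u (A a) * v (B a) ∂μ := by
  rw [L2.inner_def]
  refine integral_congr_ae ?_
  filter_upwards [Lp.coeFn_compMeasurePreserving u hA, Lp.coeFn_compMeasurePreserving v hB]
    with a h1 h2
  change inner ℝ (Lp.compMeasurePreserving A hA u a) (Lp.compMeasurePreserving B hB v a) = _
  rw [h1, h2]
  simp [mul_comm]

/-- The covariances of the shifts of `f - f_{k-1}` under a coupling. -/
theorem IsMeckeCoupling.abs_integral_shift_le (hJ : IsMeckeCoupling ρ w J) (hρ : 0 < ρ) {q : ℝ}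
    (hq : ∀ x z, (w x z).toReal ≤ q) (f : Lp ℝ 2 (nu d ρ)) (hf : ExpansionCondition f) {k : ℕ}
    (hk : 1 ≤ k) (x y : Site d) :
    |∫ r, (f - projH (k - 1) f : Lp ℝ 2 (nu d ρ)) (shift x r.1) *
        (f - projH (k - 1) f : Lp ℝ 2 (nu d ρ)) (shift y r.2) ∂J| ≤
      occBound q k * ∑' r : {r : FinConfig d × FinConfig d // r.1.degree = r.2.degree},
        |charlierCoeff f r.1.1 * charlierCoeff f r.1.2| * normSq ρ r.1.2 := by
  have hq0 : 0 ≤ q := ENNReal.toReal_nonneg.trans (hq 0 0)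
  have hA : MeasurePreserving (fun r : Config d × Config d => shift x r.1) J (nu d ρ) :=
    (measurePreserving_shift x).comp hJ.fst
  have hB : MeasurePreserving (fun r : Config d × Config d => shift y r.2) J (nu d ρ) :=
    (measurePreserving_shift y).comp hJ.snd
  rw [← inner_compMeasurePreserving hA hB]
  have hs := hasSum_sub_projH hρ f hk
  set c : FinConfig d → ℝ := fun ξ => if k ≤ ξ.degree then charlierCoeff f ξ else 0 with hc
  -- Composition with a measure preserving map is an `L²` isometry, so both expansions carry over to
  -- `L²(J)`.
  have hu := hs.mapL (Lp.compMeasurePreservingₗᵢ ℝ _ hA).toContinuousLinearMap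
  have hv := hs.mapL (Lp.compMeasurePreservingₗᵢ ℝ _ hB).toContinuousLinearMap
  refine abs_le_of_hasSum_inner hu hv fun s => ?_
  set S : Set (FinConfig d × FinConfig d) := {r | r.1.degree = r.2.degree} with hS
  set G : FinConfig d × FinConfig d → ℝ :=
    fun r => |charlierCoeff f r.1 * charlierCoeff f r.2| * normSq ρ r.2 with hG
  have hG0 : ∀ r, 0 ≤ G r := fun r => mul_nonneg (abs_nonneg _) (normSq_pos hρ _).le
  have hGs : Summable (S.indicator G) := summable_subtype_iff_indicator.1 hf
  have hterm : ∀ ξ ξ' : FinConfig d, |inner ℝ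
      (Lp.compMeasurePreservingₗᵢ ℝ _ hA (c ξ • charlierLp ρ ξ))
      (Lp.compMeasurePreservingₗᵢ ℝ _ hB (c ξ' • charlierLp ρ ξ'))| ≤
      occBound q k * S.indicator G (ξ, ξ') := by
    intro ξ ξ'
    rw [map_smul, map_smul, real_inner_smul_left, real_inner_smul_right,
      inner_compMeasurePreserving hA hB]
    have e : ∫ r, charlierLp ρ ξ (shift x r.1) * charlierLp ρ ξ' (shift y r.2) ∂J =
        pairing ρ J (ξ.mapDomain (· + x)) (ξ'.mapDomain (· + y)) := by
      refine integral_congr_ae ?_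
      filter_upwards [hA.quasiMeasurePreserving.ae (coeFn_charlierLp (ρ := ρ) ξ),
        hB.quasiMeasurePreserving.ae (coeFn_charlierLp (ρ := ρ) ξ')] with r h1 h2
      rw [h1, h2, charlierD_shift, charlierD_shift]
    have hp := hJ.abs_pairing_le hρ hq (ξ.mapDomain (· + x)) (ξ'.mapDomain (· + y))
    simp only [Finsupp.degree_mapDomain, normSq_mapDomain] at hp
    rw [e, ← mul_assoc, abs_mul]
    have hr0 : 0 ≤ occBound q k * S.indicator G (ξ, ξ') :=
      mul_nonneg (occBound_nonneg hq0 k) (Set.indicator_nonneg (fun r _ => hG0 r) _)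
    by_cases hd : ξ.degree = ξ'.degree
    · rw [if_pos hd] at hp
      by_cases hkd : k ≤ ξ.degree
      · have hmem : (ξ, ξ') ∈ S := hd
        rw [Set.indicator_of_mem hmem]
        have c1 : c ξ = charlierCoeff f ξ := if_pos hkd
        have c2 : c ξ' = charlierCoeff f ξ' := if_pos (hd ▸ hkd)
        rw [c1, c2]
        calc _ ≤ |charlierCoeff f ξ * charlierCoeff f ξ'| *
              (occBound q k * normSq ρ ξ') := by
              refine mul_le_mul_of_nonneg_left (hp.trans ?_) (abs_nonneg _)
              -- Every surviving degree is at least `k`, so the bound for `k` particles serves them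
              -- all.
              exact mul_le_mul_of_nonneg_right (occBound_antitone hq0 hkd) (normSq_pos hρ _).le
          _ = _ := by simp only [hG]; ring
      · have c1 : c ξ = 0 := if_neg hkd
        rw [c1]
        simpa using hr0
    · rw [if_neg hd] at hp
      rw [le_antisymm hp (abs_nonneg _), mul_zero]
      exact hr0
  calc _ ≤ ∑ ξ ∈ s, ∑ ξ' ∈ s, occBound q k * S.indicator G (ξ, ξ') :=
        Finset.sum_le_sum fun ξ _ => Finset.sum_le_sum fun ξ' _ => hterm ξ ξ'
    _ = occBound q k * ∑ r ∈ s ×ˢ s, S.indicator G r := by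
        rw [Finset.sum_product, Finset.mul_sum]
        simp_rw [Finset.mul_sum]
    _ ≤ occBound q k * ∑' r, S.indicator G r := by
        refine mul_le_mul_of_nonneg_left ?_ (occBound_nonneg hq0 k)
        exact hGs.sum_le_tsum _ fun r _ => Set.indicator_nonneg (fun r _ => hG0 r) _
    _ = _ := by rw [← tsum_subtype]; rfl

end Covariance

/-! ### From the Markov process to its two-time law. -/

section Walkers

variable {Ω : Type*} [MeasurableSpace Ω] {d : ℕ} {p : Site d → PMF (Site d)} {ρ : ℝ≥0}
  {P : Measure Ω} [IsProbabilityMeasure P] {η : ℝ≥0 → Ω → Config d}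

/-- The joint law of the process at times `0` and `t`. -/
theorem IsIRW.map_prodMk (hη : IsIRW p P η) (hη0 : P.map (η 0) = nu d ρ) (t : ℝ≥0) :
    P.map (fun ω => (η 0 ω, η t ω)) = jointLaw p t ρ := by
  have hm : Measurable fun ω => (η 0 ω, η t ω) := (hη.measurable 0).prodMk (hη.measurable t)
  have := Measure.isProbabilityMeasure_map (μ := P) hm.aemeasurable
  refine Measure.ext_prod fun {A B} hA hB => ?_
  have hpast : past η 0 ≤ ‹MeasurableSpace Ω› :=
    iSup₂_le fun r _ => (hη.measurable r).comap_le
  have hA0 : MeasurableSet[past η 0] (η 0 ⁻¹' A) := by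
    have h1 : MeasurableSpace.comap (η 0) inferInstance ≤ past η 0 :=
      le_iSup₂ (f := fun (r : ℝ≥0) (_ : r ≤ 0) => MeasurableSpace.comap (η r) inferInstance)
        0 le_rfl
    exact h1 _ ⟨A, hA, rfl⟩
  have hBm : MeasurableSet (η t ⁻¹' B) := hη.measurable t hB
  have hAm : MeasurableSet (η 0 ⁻¹' A) := hη.measurable 0 hA
  -- Integrate the Markov property at time `0` over an event of the past; rectangles determine the
  -- joint law.
  have h1 := setIntegral_condExp hpast
    ((integrable_const (1 : ℝ)).indicator (μ := P) hBm) hA0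
  have h2 := hη.markov 0 t B hB
  rw [zero_add] at h2
  rw [setIntegral_congr_ae hAm (h2.mono fun ω h _ => h), setIntegral_indicator hBm,
    setIntegral_const, smul_eq_mul, mul_one] at h1
  have hK : Measurable fun ζ => (irwLaw p t ζ).real B :=
    (Kernel.measurable_coe (irwKernel p t) hB).ennreal_toReal
  have h3 : ∫ ω in η 0 ⁻¹' A, (irwLaw p t (η 0 ω)).real B ∂P =
      ∫ ζ in A, (irwLaw p t ζ).real B ∂(nu d ρ) := by
    rw [← hη0, setIntegral_map hA hK.aestronglyMeasurable (hη.measurable 0).aemeasurable]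
  rw [h3] at h1
  rw [Measure.map_apply hm (hA.prod hB), jointLaw, Measure.compProd_apply_prod hA hB,
    Set.mk_preimage_prod, ← ofReal_measureReal, ← h1, ofReal_integral_eq_lintegral_ofReal]
  · refine lintegral_congr fun ζ => ?_
    rw [ofReal_measureReal, irwKernel_apply]
  · refine Integrable.of_bound hK.aestronglyMeasurable 1 (.of_forall fun ζ => ?_)
    rw [Real.norm_of_nonneg measureReal_nonneg]
    exact measureReal_le_one
  · exact .of_forall fun ζ => measureReal_nonneg

theorem IsIRW.measurePreserving (hη : IsIRW p P η) (hη0 : P.map (η 0) = nu d ρ)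
    (hp : ∀ i j, p i j = p j i) (t : ℝ≥0) : MeasurePreserving (η t) P (nu d ρ) := by
  refine ⟨hη.measurable t, ?_⟩
  have hm : Measurable fun ω => (η 0 ω, η t ω) := (hη.measurable 0).prodMk (hη.measurable t)
  rw [← (measurePreserving_snd_jointLaw (t := t) (ρ := ρ) hp).map_eq, ← hη.map_prodMk hη0 t,
    Measure.map_map measurable_snd hm]
  rfl

theorem IsIRW.memLp_shift (hη : IsIRW p P η) (hη0 : P.map (η 0) = nu d ρ)
    (hp : ∀ i j, p i j = p j i)
    (g : Lp ℝ 2 (nu d ρ)) (t : ℝ≥0) (x : Site d) :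
    MemLp (fun ω => g (shift x (η t ω))) 2 P :=
  (Lp.memLp g).comp_measurePreserving
    ((measurePreserving_shift x).comp (hη.measurePreserving hη0 hp t))

theorem IsIRW.integral_shift_sq (hη : IsIRW p P η) (hη0 : P.map (η 0) = nu d ρ)
    (hp : ∀ i j, p i j = p j i)
    (g : Lp ℝ 2 (nu d ρ)) (t : ℝ≥0) (x : Site d) :
    ∫ ω, g (shift x (η t ω)) ^ 2 ∂P = ∫ ζ, g ζ ^ 2 ∂(nu d ρ) := by
  have h := (measurePreserving_shift x).comp (hη.measurePreserving hη0 hp t)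
  have h2 := integral_map (f := fun ζ => g ζ ^ 2) h.measurable.aemeasurable
    (by rw [h.map_eq]; exact ((Lp.stronglyMeasurable g).pow 2).aestronglyMeasurable)
  rw [h.map_eq] at h2
  exact h2.symm

/-- The values of `f - f_{k-1}`, computed pointwise, along the process. -/
theorem IsIRW.ae_sub_shift (hη : IsIRW p P η) (hη0 : P.map (η 0) = nu d ρ)
    (hp : ∀ i j, p i j = p j i)
    (f h : Lp ℝ 2 (nu d ρ)) (t : ℝ≥0) :
    ∀ᵐ ω ∂P, ∀ x, f (shift x (η t ω)) - h (shift x (η t ω)) =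
      (f - h : Lp ℝ 2 (nu d ρ)) (shift x (η t ω)) := by
  rw [ae_all_iff]
  intro x
  have hx := (measurePreserving_shift x).comp (hη.measurePreserving hη0 hp t)
  filter_upwards [hx.quasiMeasurePreserving.ae (Lp.coeFn_sub f h)] with ω hω using hω.symm

end Walkers

end IRW

end

/-! ### Assembly of the estimate. -/

theorem theorem3p5 {d : ℕ} (hd : 1 ≤ d)
    (p : IRW.Site d → PMF (IRW.Site d)) (hp : IRW.IsWalkTransition p)
    (ρ : ℝ≥0) (hρ : 0 < ρ)
    {Ω : Type*} [MeasurableSpace Ω] (P : Measure Ω) [IsProbabilityMeasure P]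
    (η : ℝ≥0 → Ω → IRW.Config d) (hη : IRW.IsIRW p P η)
    (hη0 : P.map (η 0) = IRW.nu d ρ)
    (f : Lp ℝ 2 (IRW.nu d ρ)) (hf : IRW.ExpansionCondition f)
    (k : ℕ) (hk : 1 ≤ k)
    (φ : 𝓢(EuclideanSpace ℝ (Fin d), ℝ)) (t : ℝ≥0) (ht : 0 < t) :
    -- the series that defines the field converges absolutely, almost surely, at every time
    (∀ N : ℕ, 1 ≤ N → ∀ s : ℝ≥0, ∀ᵐ ω ∂P, Summable fun x : IRW.Site d =>
      φ (IRW.scaled N x) *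
        (f (IRW.shift x (η s ω)) - IRW.projH (k - 1) f (IRW.shift x (η s ω)))) ∧
    -- the expectation below exists
    (∀ N : ℕ, 1 ≤ N → Integrable (fun ω =>
      IRW.fluctField N φ (fun ζ => f ζ - IRW.projH (k - 1) f ζ) (η 0 ω) *
        IRW.fluctField N φ (fun ζ => f ζ - IRW.projH (k - 1) f ζ) (η ((N : ℝ≥0) ^ 2 * t) ω)) P) ∧
    ∃ C : ℝ, ∀ N : ℕ, 1 ≤ N →
      |∫ ω, IRW.fluctField N φ (fun ζ => f ζ - IRW.projH (k - 1) f ζ) (η 0 ω) *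
        IRW.fluctField N φ (fun ζ => f ζ - IRW.projH (k - 1) f ζ)
          (η ((N : ℝ≥0) ^ 2 * t) ω) ∂P|
        ≤ C * (N : ℝ) ^ (-(d : ℤ) * ((k : ℤ) - 2)) := by
  open IRW in
  set g : Lp ℝ 2 (nu d ρ) := f - projH (k - 1) f with hg
  set M := ∫ ζ, g ζ ^ 2 ∂(nu d ρ) with hM
  set S := ∑' r : {r : FinConfig d × FinConfig d // r.1.degree = r.2.degree},
        |charlierCoeff f r.1.1 * charlierCoeff f r.1.2| * normSq ρ r.1.2 with hS
  have hS0 : 0 ≤ S := tsum_nonneg fun r => mul_nonneg (abs_nonneg _) (normSq_pos hρ _).le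
  obtain ⟨A, hA0, hA⟩ := exists_tsum_schwartz_le φ
  obtain ⟨K, hK0, hK⟩ := exists_walkLaw_le hp
  have hae := fun s => hη.ae_sub_shift hη0 hp.symm f (projH (k - 1) f) s
  have hL := hη.memLp_shift hη0 hp.symm g
  have hLM : ∀ s x, ∫ ω, g (shift x (η s ω)) ^ 2 ∂P ≤ M := fun s x =>
    (hη.integral_shift_sq hη0 hp.symm g s x).le
  have hfield : ∀ (N : ℕ) (s : ℝ≥0), ∀ᵐ ω ∂P,
      fluctField N φ (fun ζ => f ζ - projH (k - 1) f ζ) (η s ω) =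
        ∑' x, φ (scaled N x) * g (shift x (η s ω)) := by
    intro N s
    filter_upwards [hae s] with ω hω
    exact tsum_congr fun x => congrArg (φ (scaled N x) * ·) (hω x)
  have hmain : ∀ N : ℕ, 1 ≤ N →
      Integrable (fun ω => (∑' x, φ (scaled N x) * g (shift x (η 0 ω))) *
        ∑' x, φ (scaled N x) * g (shift x (η ((N : ℝ≥0) ^ 2 * t) ω))) P ∧
      |∫ ω, (∑' x, φ (scaled N x) * g (shift x (η 0 ω))) *
        ∑' x, φ (scaled N x) * g (shift x (η ((N : ℝ≥0) ^ 2 * t) ω)) ∂P| ≤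
        (∑' x : Site d, |φ (scaled N x)|) ^ 2 * (occBound ((K / √t / N) ^ d) k * S) := by
    intro N hN
    set T : ℝ≥0 := (N : ℝ≥0) ^ 2 * t with hT
    have hN' : (0 : ℝ≥0) < N := by exact_mod_cast hN
    have hsqrt : √(T : ℝ) = √t * N := by
      rw [hT]
      push_cast
      rw [mul_comm, Real.sqrt_mul (by positivity), Real.sqrt_sq (by positivity)]
    -- Since `√T = √t * N`, the heat kernel bound at the diffusive time carries the factor `N ^
    -- (-d)`.
    have hq : ∀ x z, (walkLaw p T x z).toReal ≤ (K / √t / N) ^ d := by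
      intro x z
      have := hK T (by positivity) x z
      rwa [hsqrt, ← div_div] at this
    refine integrable_series_mul_and_bound (hA N hN).1 (hL 0) (hL T) (hLM 0) (hLM T) fun x y => ?_
    have h1 := (isMeckeCoupling_jointLaw (ρ := ρ) hp.symm T).abs_integral_shift_le hρ hq f hf hk x y
    have hm : Measurable fun ω => (η 0 ω, η T ω) := (hη.measurable 0).prodMk (hη.measurable T)
    have hgm : Measurable g := (Lp.stronglyMeasurable g).measurable
    have hgx : Measurable fun r : Config d × Config d => g (shift x r.1) * g (shift y r.2) :=
      (hgm.comp ((measurable_shift x).comp measurable_fst)).mul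
        (hgm.comp ((measurable_shift y).comp measurable_snd))
    rw [← hη.map_prodMk hη0 T, integral_map hm.aemeasurable hgx.aestronglyMeasurable] at h1
    exact h1
  have hcongr : ∀ N : ℕ, (fun ω => (∑' x, φ (scaled N x) * g (shift x (η 0 ω))) *
        ∑' x, φ (scaled N x) * g (shift x (η ((N : ℝ≥0) ^ 2 * t) ω))) =ᵐ[P]
      fun ω => fluctField N φ (fun ζ => f ζ - projH (k - 1) f ζ) (η 0 ω) *
        fluctField N φ (fun ζ => f ζ - projH (k - 1) f ζ) (η ((N : ℝ≥0) ^ 2 * t) ω) := by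
    intro N
    filter_upwards [hfield N 0, hfield N ((N : ℝ≥0) ^ 2 * t)] with ω h1 h2
    rw [h1, h2]
  refine ⟨fun N hN s => ?_, fun N hN => (hmain N hN).1.congr (hcongr N),
    -- `A ^ 2` comes from the two lattice sums of `|φ|`, `k! * ((K / √t) ^ d) ^ k` from
    -- `occBound_le` without its power of `N`, and `S` is the sum in the expansion condition.
    A ^ 2 * (k.factorial * ((K / √t) ^ d) ^ k * S), fun N hN => ?_⟩
  · filter_upwards [ae_summable_mul (hA N hN).1 (hL s) (hLM s), hae s] with ω h1 h2
    simp_rw [h2]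
    exact h1.of_norm
  · rw [← integral_congr_ae (hcongr N)]
    refine (hmain N hN).2.trans ?_
    have hN0 : (0 : ℝ) < N := by exact_mod_cast hN
    have hocc := occBound_le (q := (K / √t / N) ^ d) (by positivity) k
    have hsum0 : 0 ≤ ∑' x : Site d, |φ (scaled N x)| := tsum_nonneg fun _ => abs_nonneg _
    calc (∑' x : Site d, |φ (scaled N x)|) ^ 2 * (occBound ((K / √t / N) ^ d) k * S)
        ≤ (A * (N : ℝ) ^ d) ^ 2 * ((k.factorial * ((K / √t / N) ^ d) ^ k) * S) := by
          gcongr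
          · exact mul_nonneg (occBound_nonneg (by positivity) k) hS0
          · exact (hA N hN).2
      _ = A ^ 2 * (k.factorial * ((K / √t) ^ d) ^ k * S) *
          (N : ℝ) ^ (-(d : ℤ) * ((k : ℤ) - 2)) := by
          have e : (N : ℝ) ^ (-(d : ℤ) * ((k : ℤ) - 2)) = ((N : ℝ) ^ d) ^ 2 / ((N : ℝ) ^ d) ^ k := by
            rw [show -(d : ℤ) * ((k : ℤ) - 2) = ((d * 2 : ℕ) : ℤ) - ((d * k : ℕ) : ℤ) by
              push_cast; ring, zpow_sub₀ hN0.ne', zpow_natCast, zpow_natCast, pow_mul, pow_mul]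
          rw [e, div_pow (K / √t), div_pow]
          ring
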